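/- Fix $0<\delta\le \tfrac12$ and let $k=k_n=\lfloor n^{1/2-\delta}\rfloor$. For $\mu\in\mathbb R$, $\sigma_0,\sigma_1>0$ and $S\subseteq\{1,\dots,n\}$ with $|S|=k$, let $F=N(0,\sigma_0^2)^{\otimes n}$ and let $F_S$ be the hidden hubs distribution on $\mathbb R^n$ with planted set $S$: coordinates outside $S$ are independent $N(0,\sigma_0^2)$, and on $S$ the distribution is a mixture of $N(0,\sigma_0^2)$ (weight $1-\frac kn$) and $N(\mu,\sigma_1^2)$ (weight $\frac kn$). The results below hold in both versions of this model: (i) with probability $\frac kn$ all coordinates in $S$ are (independently) drawn from $N(\mu,\sigma_1^2)$, and otherwise the sample is drawn from $F$; (ii) each coordinate in $S$ is drawn from the mixture independently. The detection problem $\mathcal P$ is to decide whether an unknown input distribution is $F$ or is one of the $F_S$. A randomized statistical algorithm adaptively queries an oracle for the input distribution $D$ on (measurable) functions $f:\mathbb R^n\to\{0,1\}$. VSTAT$(t)$, for an integer $t>0$, may answer with any number within $\max\{1/t,\sqrt{\mathrm{Var}_D(f)/t}\}$ of $\mathbb E_D f$; $1$-STAT answers with $f(x)$ for a fresh sample $x\sim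 D$. The algorithm solves $\mathcal P$ with probability at least $3/4$ if for each of the possible input distributions, and whatever legal answers VSTAT gives, its verdict is right with probability at least $3/4$ (over its own randomness and, for $1$-STAT, the samples). It may depend on $n,k,\mu,\sigma_0,\sigma_1$. It "needs $N$ calls" if any bound $q$ on its number of calls satisfies $q\ge N$. Asymptotics are for $n\to\infty$, with $\delta$ fixed, and VSTAT$(n^{1+\delta})$ means VSTAT$(\lceil n^{1+\delta}\rceil)$. Every statistical algorithm that solves $\mathcal P$ with probability at least $3/4$ needs: 1. for $\mu=0$ and $c\sigma_0^2\le\sigma_1^2\le 2\sigma_0^2(1-\varepsilon)$, for any constants $c,\varepsilon>0$: $n^{\Omega(\log n)}$ calls to VSTAT$(n^{1+\delta})$, with implied constants depending only on $c,\varepsilon,\delta$; 2. for $\mu=0$ and $\sigma_1^2=2\sigma_0^2$: $n^{\Omega(\log n/\log\log n)}$ calls to VSTAT$(n^{1+\delta})$, with implied constants depending only on $\delta$; 3. for $\mu=0$ and $c\sigma_0^2\le\sigma_1^2\le(2+o(\delta))\sigma_0^2$, for any constant $c>0$: $n^{\omega(1)}$ calls to VSTAT$(n^{1+\delta})$, where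 the $\omega(1)$ depends only on $c$, $\delta$ and the sequence denoted $o(\delta)$; 4. for $\sigma_1=\sigma_0=\sigma$ and $\mu^2=o(\sigma^2\ln(\sqrt n/k))$ (where $\mu=\mu_n$ and $\sigma=\sigma_n$ may depend on $n$): $n^{\omega(1)}$ calls to VSTAT$(n^{1+\delta})$. Moreover, in each of these settings every statistical algorithm that uses $1$-STAT and solves $\mathcal P$ with probability at least $3/4$ needs $\Omega(n^{1+\delta})$ calls to $1$-STAT. -/

import Mathlib

open MeasureTheory ProbabilityTheory Filter Asymptotics
open scoped NNReal ENNReal Topology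

/-- A deterministic adaptive statistical algorithm over the domain `X`: it either stops with a
verdict (`true` means "planted", `false` means "not planted"), or it calls its oracle on a
measurable `0/1`-valued function `f` and continues in a way that depends on the response,
which lies in `A`. -/
inductive StatAlg (X A : Type) [MeasurableSpace X] : Type
  | output (b : Bool) : StatAlg X A
  | call (f : X → Bool) (hf : Measurable f) (next : A → StatAlg X A) : StatAlg X A

namespace StatAlg

variable {X A : Type} [MeasurableSpace X]

/-- The algorithm makes at most `q` oracle calls, whatever the responses are. (An algorithm that
keeps to this budget only on legal responses can be cut off after `q` calls.) -/
def MakesAtMost : StatAlg X A → ℕ → Prop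
  | output _, _ => True
  | call _ _ _, 0 => False
  | call _ _ next, q + 1 => ∀ a : A, MakesAtMost (next a) q

/-- The verdict when the oracle answers the query `f` by the number `O f`. -/
def run : StatAlg X ℝ → ((X → Bool) → ℝ) → Bool
  | output b, _ => b
  | call f _ next, O => run (next (O f)) O

/-- The probability that the verdict is `b` when every call on a function `f` is answered by
`f x` for a fresh independent sample `x` from `D`. -/
noncomputable def verdictProb (D : Measure X) : StatAlg X Bool → Bool → ℝ≥0∞
  | output b', b => if b' = b then 1 else 0
  | call f _ next, b =>
      D {x | f x = true} * verdictProb D (next true) b +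
        D {x | f x = false} * verdictProb D (next false) b

end StatAlg

section Oracles

variable {X : Type} [MeasurableSpace X]

/-- The expectation of the `0/1`-valued function `f` under `D`. -/
noncomputable def queryMean (D : Measure X) (f : X → Bool) : ℝ := D.real {x | f x = true}

/-- `O` is a legal `VSTAT(t)` oracle for `D`: it answers every `0/1`-valued function within
`max {1/t, √(Var_D f / t)}` of its expectation. -/
def IsVSTAT (D : Measure X) (t : ℕ) (O : (X → Bool) → ℝ) : Prop :=
  ∀ f : X → Bool, Measurable f →
    |O f - queryMean D f| ≤
      max (1 / (t : ℝ)) (Real.sqrt (queryMean D f * (1 - queryMean D f) / t))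

/-- The randomized algorithm that draws `ω` from `P` and then follows `alg ω` decides, with
probability at least `3/4`, whether the input distribution is `U` or belongs to `𝒟`, whatever
legal `VSTAT(t)` oracle it is given. As `P` of an arbitrary set is the outer measure, the clauses
say that the event of a right verdict has inner probability at least `3/4`. -/
def SolvesWithVSTAT {Ω : Type} [MeasurableSpace Ω] (P : Measure Ω) (alg : Ω → StatAlg X ℝ)
    (U : Measure X) (𝒟 : Set (Measure X)) (t : ℕ) : Prop :=
  (∀ O, IsVSTAT U t O → P {ω | (alg ω).run O ≠ false} ≤ 1 / 4) ∧
    ∀ D ∈ 𝒟, ∀ O, IsVSTAT D t O → P {ω | (alg ω).run O ≠ true} ≤ 1 / 4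

/-- The same for the oracle `1-STAT`; the probability is over the randomness of the algorithm and
over the samples. (`∫⁻` of an arbitrary function is the lower integral, so that again no
measurability has to be assumed.) -/
def SolvesWithOneSTAT {Ω : Type} [MeasurableSpace Ω] (P : Measure Ω) (alg : Ω → StatAlg X Bool)
    (U : Measure X) (𝒟 : Set (Measure X)) : Prop :=
  3 / 4 ≤ ∫⁻ ω, (alg ω).verdictProb U false ∂P ∧
    ∀ D ∈ 𝒟, 3 / 4 ≤ ∫⁻ ω, (alg ω).verdictProb D true ∂P

/-- Every randomized statistical algorithm that decides between `U` and `𝒟` with probability at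
least `3/4` needs at least `N` calls to `VSTAT(t)`. -/
def NeedsVSTATCalls (U : Measure X) (𝒟 : Set (Measure X)) (t : ℕ) (N : ℝ) : Prop :=
  ∀ (Ω : Type) [MeasurableSpace Ω] (P : Measure Ω) [IsProbabilityMeasure P]
    (alg : Ω → StatAlg X ℝ) (q : ℕ),
    (∀ ω, (alg ω).MakesAtMost q) → SolvesWithVSTAT P alg U 𝒟 t → N ≤ q

/-- Every randomized statistical algorithm that decides between `U` and `𝒟` with probability at
least `3/4` needs at least `N` calls to `1-STAT`. -/
def NeedsOneSTATCalls (U : Measure X) (𝒟 : Set (Measure X)) (N : ℝ) : Prop :=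
  ∀ (Ω : Type) [MeasurableSpace Ω] (P : Measure Ω) [IsProbabilityMeasure P]
    (alg : Ω → StatAlg X Bool) (q : ℕ),
    (∀ ω, (alg ω).MakesAtMost q) → SolvesWithOneSTAT P alg U 𝒟 → N ≤ q

end Oracles

/-- The distribution with no planting: `N(0, σ₀²)` independently in every coordinate. -/
noncomputable def unplanted (n : ℕ) (σ₀ : ℝ≥0) : Measure (Fin n → ℝ) :=
  Measure.pi fun _ => gaussianReal 0 (σ₀ ^ 2)

/-- How the coordinates in the planted set use the mixture of `N(0, σ₀²)` and `N(m, σ₁²)`: a sample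
takes the second component on all of them simultaneously (with probability `k/n`), or each of
them takes it independently of the others (with probability `k/n` each). -/
inductive PlantingModel : Type
  | simultaneous
  | independent

/-- The hidden hubs distribution with planted set `S` and mixing weight `k/n`. -/
noncomputable def planted (n k : ℕ) (m : ℝ) (σ₀ σ₁ : ℝ≥0) (S : Finset (Fin n)) :
    PlantingModel → Measure (Fin n → ℝ)
  | .simultaneous =>
      (1 - (k : ℝ≥0∞) / n) • unplanted n σ₀ +
        ((k : ℝ≥0∞) / n) •
          Measure.pi fun i => if i ∈ S then gaussianReal m (σ₁ ^ 2) else gaussianReal 0 (σ₀ ^ 2)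
  | .independent =>
      Measure.pi fun i =>
        if i ∈ S then
          (1 - (k : ℝ≥0∞) / n) • gaussianReal 0 (σ₀ ^ 2) +
            ((k : ℝ≥0∞) / n) • gaussianReal m (σ₁ ^ 2)
        else gaussianReal 0 (σ₀ ^ 2)

/-- All hidden hubs distributions with a planted set of size `k`. -/
def plantedFamily (M : PlantingModel) (n k : ℕ) (m : ℝ) (σ₀ σ₁ : ℝ≥0) :
    Set (Measure (Fin n → ℝ)) :=
  {D | ∃ S : Finset (Fin n), S.card = k ∧ D = planted n k m σ₀ σ₁ S M}

/-- The size `n^(1/2 - δ)` of the planting, rounded down to an integer. -/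
noncomputable def plantSize (δ : ℝ) (n : ℕ) : ℕ := ⌊(n : ℝ) ^ (1 / 2 - δ)⌋₊

/-- For a planting of size `n^(1/2 - δ)`, detection with probability at least `3/4` needs at
least `N` calls to `VSTAT(n^(1+δ))` (with `n^(1+δ)` rounded up to an integer). -/
def DetectionNeedsVSTAT (M : PlantingModel) (δ : ℝ) (n : ℕ) (m : ℝ) (σ₀ σ₁ : ℝ≥0) (N : ℝ) :
    Prop :=
  NeedsVSTATCalls (unplanted n σ₀) (plantedFamily M n (plantSize δ n) m σ₀ σ₁)
    ⌈(n : ℝ) ^ (1 + δ)⌉₊ N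

/-- For a planting of size `n^(1/2 - δ)`, detection with probability at least `3/4` needs at
least `N` calls to `1-STAT`. -/
def DetectionNeedsOneSTAT (M : PlantingModel) (δ : ℝ) (n : ℕ) (m : ℝ) (σ₀ σ₁ : ℝ≥0) (N : ℝ) :
    Prop :=
  NeedsOneSTATCalls (unplanted n σ₀) (plantedFamily M n (plantSize δ n) m σ₀ σ₁) N

/-!
Let `U` be the unplanted distribution, `κ = k / n`, `t = ⌈n ^ (1 + δ)⌉`, and let `D S` be the
distribution with planted set `S`. The theorem holds because every single query tells only a tiny
fraction of the `D S` from `U`: its expectation under `U` is a legal answer of `VSTAT(t)` for all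
other `S`.

*From one query to algorithms.* Suppose a query distinguishes at most a fraction `1 / N` of the
planted sets. If the oracle for `D S` answers as if the input were `U` whenever this is legal, an
algorithm with `q` calls to `VSTAT(t)` runs on `D S` as it does on `U` for all but a fraction
`q / N` of the `S`, so `q ≥ N / 2` (`needsVSTATCalls_of_card_distinguished_le`). For `1-STAT`, a
query that does not distinguish has answer bits of Hellinger affinity at least `1 - 1 / t`;
affinities multiply along an adaptive run, so that the order of `t` calls are needed before the
verdicts on `D S` and `U` can differ, unless a distinguishing query is met
(`needsOneSTATCalls_of_card_distinguished_le`).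

*One query.* Let `A` be a set of planted sets for which a query of expectation `p ≤ 1 / 2` deviates
in the same direction. Each deviation is at least of order `√(p / t)`, and by Cauchy–Schwarz the
square of their sum is at most `p` times the sum of the correlations of the densities over `A × A`
(`card_distinguished_le`). In both planting models this correlation is at most
`2 κ² X ^ |S ∩ T|`, where `X - 1` bounds the second moment of the density ratio of
`N(m, σ₁²)` and `N(0, σ₀²)` (`densityCorrelation_plantedDensity_le`). Intersections of size `l` have
probability at most about `n ^ (-2 δ l)`, so that over a set `A` of relative size above
`n ^ (-2 δ s)` the average of `X ^ |S ∩ T|` is of order `X ^ s`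
(`sum_sum_pow_card_inter_le`). As `t κ²` is of order `n ^ (-δ)`, the choice `X ^ s = n ^ (δ / 2)`
makes such a set `A` impossible; this is `N = n ^ (2 δ s) = n ^ (δ² log n / log X)`.

*The second moment.* For variance ratios away from `2` and for equal variances the second moment of
the density ratio is an explicit Gaussian integral: a constant, respectively `exp (m² / σ²)`. For
ratios near or above `2` it may be infinite. There the density is truncated at
`√(18 log n)` standard deviations, which costs mass `n ^ (-2)`, below the tolerance of the oracle,
and leaves a second moment that is polylogarithmic for the ratio `2` and `n ^ o(1)` for the ratio
`2 + o(1)`. So all the densities above are allowed to have total mass slightly below one.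
-/

/-! ### Legal answers and the oracles that hide a planting -/

/-- The answer `y` to a query of expectation `p` is legal for `VSTAT(t)`. -/
def LegalAnswer (t : ℕ) (p y : ℝ) : Prop :=
  |y - p| ≤ max (1 / (t : ℝ)) (Real.sqrt (p * (1 - p) / t))

lemma LegalAnswer.refl (t : ℕ) (p : ℝ) : LegalAnswer t p p := by
  simp [LegalAnswer]

lemma setOf_eq_false {X : Type} (f : X → Bool) : {x | f x = false} = {x | f x = true}ᶜ := by
  ext x
  simp

section Queries

variable {X ι : Type} [MeasurableSpace X]

lemma measurableSet_eq_true {f : X → Bool} (hf : Measurable f) : MeasurableSet {x | f x = true} :=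
  hf (measurableSet_singleton true)

open Classical in
/-- The indices `i ∈ I` for which the query `f` tells `D i` from `U`: its expectation under `U` is
not a legal answer of `VSTAT(t)` for `D i`. -/
noncomputable def distinguished (U : Measure X) (D : ι → Measure X) (t : ℕ) (I : Finset ι)
    (f : X → Bool) : Finset ι :=
  {i ∈ I | ¬ LegalAnswer t (queryMean (D i) f) (queryMean U f)}

open Classical in
/-- The `VSTAT(t)` oracle for `D` that answers as if the input distribution were `U` wherever this
is legal. -/
noncomputable def hidingOracle (U D : Measure X) (t : ℕ) (f : X → Bool) : ℝ :=
  if LegalAnswer t (queryMean D f) (queryMean U f) then queryMean U f else queryMean D f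

lemma isVSTAT_hidingOracle (U D : Measure X) (t : ℕ) : IsVSTAT D t (hidingOracle U D t) := by
  intro f _
  change LegalAnswer t (queryMean D f) (hidingOracle U D t f)
  unfold hidingOracle
  split_ifs with h
  · exact h
  · exact .refl t _

lemma isVSTAT_queryMean (U : Measure X) (t : ℕ) : IsVSTAT U t (queryMean U) :=
  fun f _ => LegalAnswer.refl t (queryMean U f)

open Classical in
/-- Against the hiding oracles, an algorithm follows the path it takes on `U` until a query
distinguishes the planting, so `q` queries change the verdict for few indices only. -/
lemma card_run_hidingOracle_ne_le {U : Measure X} {D : ι → Measure X} {t : ℕ} {I : Finset ι}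
    {β : ℝ} (hβ : ∀ f, Measurable f → ((distinguished U D t I f).card : ℝ) ≤ β)
    (alg : StatAlg X ℝ) (q : ℕ) (hq : alg.MakesAtMost q) :
    (({i ∈ I | alg.run (hidingOracle U (D i) t) ≠ alg.run (queryMean U)} : Finset ι).card : ℝ) ≤
      q * β := by
  induction alg generalizing q with
  | output b =>
    have h0 : 0 ≤ β := (Nat.cast_nonneg _).trans (hβ (fun _ => true) measurable_const)
    simpa [StatAlg.run] using mul_nonneg (Nat.cast_nonneg q) h0
  | call f hf next ih =>
    cases q with
    | zero => exact hq.elim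
    | succ q =>
      have hsub : ({i ∈ I | (StatAlg.call f hf next).run (hidingOracle U (D i) t) ≠
            (StatAlg.call f hf next).run (queryMean U)} : Finset ι) ⊆
          distinguished U D t I f ∪
            {i ∈ I | (next (queryMean U f)).run (hidingOracle U (D i) t) ≠
              (next (queryMean U f)).run (queryMean U)} := by
        intro i hi
        rw [Finset.mem_filter] at hi
        simp only [StatAlg.run] at hi
        simp only [distinguished, Finset.mem_union, Finset.mem_filter]
        by_cases hg : LegalAnswer t (queryMean (D i) f) (queryMean U f)
        · right
          refine ⟨hi.1, ?_⟩
          have : hidingOracle U (D i) t f = queryMean U f := by simp [hidingOracle, hg]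
          rw [this] at hi
          exact hi.2
        · exact Or.inl ⟨hi.1, hg⟩
      calc _ ≤ (((distinguished U D t I f).card +
              ({i ∈ I | (next (queryMean U f)).run (hidingOracle U (D i) t) ≠
              (next (queryMean U f)).run (queryMean U)} : Finset ι).card : ℕ) : ℝ) := by
            exact_mod_cast (Finset.card_le_card hsub).trans (Finset.card_union_le _ _)
        _ ≤ β + q * β := by
            push_cast
            exact add_le_add (hβ f hf) (ih _ q (hq _))
        _ = _ := by push_cast; ring

open Classical in
/-- If every query distinguishes at most a fraction `1/N` of the plantings, detection needs `N/2`
calls to `VSTAT(t)`. -/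
theorem needsVSTATCalls_of_card_distinguished_le {U : Measure X} {D : ι → Measure X} {t : ℕ}
    {I : Finset ι} {𝒟 : Set (Measure X)} {N : ℝ} (hI : I.Nonempty) (hN : 0 < N)
    (hD : ∀ i ∈ I, D i ∈ 𝒟)
    (hcard : ∀ f, Measurable f → ((distinguished U D t I f).card : ℝ) ≤ I.card / N) :
    NeedsVSTATCalls U 𝒟 t (N / 2) := by
  intro Ω _ P _ alg q hq hsol
  have hIpos : (0 : ℝ) < I.card := by exact_mod_cast hI.card_pos
  -- `E i` may fail to be measurable and is replaced by its measurable hull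
  set E : ι → Set Ω := fun i =>
    {ω | (alg ω).run (hidingOracle U (D i) t) = (alg ω).run (queryMean U)} with hE
  have hEP : ∀ i ∈ I, P (toMeasurable P (E i)) ≤ 1 / 2 := by
    intro i hi
    rw [measure_toMeasurable]
    have hsub : E i ⊆ {ω | (alg ω).run (queryMean U) ≠ false} ∪
        {ω | (alg ω).run (hidingOracle U (D i) t) ≠ true} := by
      intro ω hω
      simp only [hE, Set.mem_ofPred_eq] at hω
      simp only [Set.mem_union, Set.mem_ofPred_eq, hω]
      cases (alg ω).run (queryMean U) <;> simp
    refine (measure_mono hsub).trans ((measure_union_le _ _).trans ?_)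
    refine (add_le_add (hsol.1 _ (isVSTAT_queryMean U t))
      (hsol.2 _ (hD i hi) _ (isVSTAT_hidingOracle U (D i) t))).trans (le_of_eq ?_)
    rw [ENNReal.div_add_div_same, ENNReal.div_eq_div_iff] <;> norm_num
  have hpt : ∀ ω, ENNReal.ofReal (I.card - q * (I.card / N)) ≤
      ∑ i ∈ I, (toMeasurable P (E i)).indicator 1 ω := by
    intro ω
    have h1 := card_run_hidingOracle_ne_le hcard (alg ω) q (hq ω)
    have h2 : (({i ∈ I | ω ∈ E i} : Finset ι).card : ℝ) +
        (({i ∈ I | ¬ ω ∈ E i} : Finset ι).card : ℝ) = I.card := by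
      exact_mod_cast Finset.card_filter_add_card_filter_not (s := I) (fun i => ω ∈ E i)
    have h3 : ENNReal.ofReal (I.card - q * (I.card / N)) ≤
        (({i ∈ I | ω ∈ E i} : Finset ι).card : ℝ≥0∞) := by
      rw [← ENNReal.ofReal_natCast]
      refine ENNReal.ofReal_le_ofReal ?_
      have : (({i ∈ I | ¬ ω ∈ E i} : Finset ι).card : ℝ) ≤ q * (I.card / N) := h1
      linarith
    refine h3.trans ?_
    rw [Finset.card_filter]
    push_cast
    refine Finset.sum_le_sum fun i _ => ?_
    by_cases hi : ω ∈ E i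
    · simp [hi, subset_toMeasurable P (E i) hi]
    · simp [hi]
  have hint : ENNReal.ofReal (I.card - q * (I.card / N)) ≤ ENNReal.ofReal (I.card * (1 / 2)) := by
    calc ENNReal.ofReal (I.card - q * (I.card / N))
        = ∫⁻ _, ENNReal.ofReal (I.card - q * (I.card / N)) ∂P := by simp
      _ ≤ ∫⁻ ω, ∑ i ∈ I, (toMeasurable P (E i)).indicator 1 ω ∂P := lintegral_mono hpt
      _ = ∑ i ∈ I, P (toMeasurable P (E i)) := by
          rw [lintegral_finsetSum]
          · exact Finset.sum_congr rfl fun i _ =>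
              lintegral_indicator_one (measurableSet_toMeasurable _ _)
          · exact fun i _ => measurable_one.indicator (measurableSet_toMeasurable _ _)
      _ ≤ ∑ i ∈ I, (1 / 2 : ℝ≥0∞) := Finset.sum_le_sum hEP
      _ = ENNReal.ofReal (I.card * (1 / 2)) := by
          rw [ENNReal.ofReal_mul (Nat.cast_nonneg _)]
          simp
  rw [ENNReal.ofReal_le_ofReal_iff (by positivity)] at hint
  have h4 : I.card * (N / 2) ≤ I.card * (q : ℝ) := by
    have : q * (I.card / N) * N = q * I.card := by field_simp
    nlinarith
  exact le_of_mul_le_mul_left h4 hIpos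

/-! ### The affinity of two Bernoulli distributions -/

/-- The Hellinger affinity of the Bernoulli distributions with parameters `p` and `p'`. -/
noncomputable def bernoulliAffinity (p p' : ℝ) : ℝ :=
  √p * √p' + √(1 - p) * √(1 - p')

lemma sqrt_mul_sqrt_add_le {a b c d : ℝ} (ha : 0 ≤ a) (hb : 0 ≤ b) (hc : 0 ≤ c) (hd : 0 ≤ d) :
    √a * √c + √b * √d ≤ √(a + b) * √(c + d) := by
  rw [← Real.sqrt_mul (by positivity : 0 ≤ a + b)]
  refine Real.le_sqrt_of_sq_le ?_
  have h1 := Real.sq_sqrt ha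
  have h2 := Real.sq_sqrt hb
  have h3 := Real.sq_sqrt hc
  have h4 := Real.sq_sqrt hd
  calc (√a * √c + √b * √d) ^ 2 ≤ (√a ^ 2 + √b ^ 2) * (√c ^ 2 + √d ^ 2) := by
        nlinarith [sq_nonneg (√a * √d - √b * √c)]
    _ = _ := by rw [h1, h2, h3, h4]

/-- The affinity of two verdicts, each reached through an answer bit with parameter `p` or `p'`,
in terms of the affinities of the verdicts given the bit. -/
lemma bernoulliAffinity_mixture_le {p p' v w v' w' : ℝ}
    (hp : p ∈ Set.Icc (0 : ℝ) 1) (hp' : p' ∈ Set.Icc (0 : ℝ) 1)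
    (hv : v ∈ Set.Icc (0 : ℝ) 1) (hw : w ∈ Set.Icc (0 : ℝ) 1)
    (hv' : v' ∈ Set.Icc (0 : ℝ) 1) (hw' : w' ∈ Set.Icc (0 : ℝ) 1) :
    √p * √p' * bernoulliAffinity v v' + √(1 - p) * √(1 - p') * bernoulliAffinity w w' ≤
      bernoulliAffinity (p * v + (1 - p) * w) (p' * v' + (1 - p') * w') := by
  obtain ⟨hp0, hp1⟩ := hp
  obtain ⟨hp0', hp1'⟩ := hp'
  obtain ⟨hv0, hv1⟩ := hv
  obtain ⟨hw0, hw1⟩ := hw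
  obtain ⟨hv0', hv1'⟩ := hv'
  obtain ⟨hw0', hw1'⟩ := hw'
  have e1 : 1 - (p * v + (1 - p) * w) = p * (1 - v) + (1 - p) * (1 - w) := by ring
  have e2 : 1 - (p' * v' + (1 - p') * w') = p' * (1 - v') + (1 - p') * (1 - w') := by ring
  have h1 := sqrt_mul_sqrt_add_le (mul_nonneg hp0 hv0) (mul_nonneg (sub_nonneg.2 hp1) hw0)
    (mul_nonneg hp0' hv0') (mul_nonneg (sub_nonneg.2 hp1') hw0')
  have h2 := sqrt_mul_sqrt_add_le (mul_nonneg hp0 (sub_nonneg.2 hv1))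
    (mul_nonneg (sub_nonneg.2 hp1) (sub_nonneg.2 hw1))
    (mul_nonneg hp0' (sub_nonneg.2 hv1')) (mul_nonneg (sub_nonneg.2 hp1') (sub_nonneg.2 hw1'))
  rw [Real.sqrt_mul hp0, Real.sqrt_mul hp0', Real.sqrt_mul (sub_nonneg.2 hp1),
    Real.sqrt_mul (sub_nonneg.2 hp1')] at h1 h2
  unfold bernoulliAffinity
  rw [e1, e2]
  nlinarith

lemma sq_sqrt_sub_sqrt_le_abs {p p' : ℝ} (hp : 0 ≤ p) (hp' : 0 ≤ p') :
    (√p - √p') ^ 2 ≤ |p - p'| := by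
  have h1 := Real.sq_sqrt hp
  have h2 := Real.sq_sqrt hp'
  have h3 := Real.sqrt_nonneg p
  have h4 := Real.sqrt_nonneg p'
  rcases le_total p p' with h | h
  · have := Real.sqrt_le_sqrt h
    rw [abs_of_nonpos (by linarith)]
    nlinarith
  · have := Real.sqrt_le_sqrt h
    rw [abs_of_nonneg (by linarith)]
    nlinarith

lemma sq_sqrt_sub_sqrt_le_of_sq_sub_le {p p' s : ℝ} (hp : 0 ≤ p) (hp' : 0 ≤ p') (hs : 0 ≤ s)
    (h : (p - p') ^ 2 ≤ p' * s) : (√p - √p') ^ 2 ≤ s := by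
  have h1 := Real.sq_sqrt hp
  have h2 := Real.sq_sqrt hp'
  have h3 := Real.sqrt_nonneg p
  have h4 := Real.sqrt_nonneg p'
  rcases hp'.eq_or_lt with rfl | hpos
  · have : p = 0 := by nlinarith
    simpa [this] using hs
  · have e : (p - p') ^ 2 = (√p - √p') ^ 2 * (√p + √p') ^ 2 := by
      rw [← mul_pow]
      congr 1
      nlinarith
    have h5 : p' ≤ (√p + √p') ^ 2 := by nlinarith [mul_nonneg h3 h4]
    have h6 : (√p - √p') ^ 2 * p' ≤ s * p' := by
      nlinarith [mul_le_mul_of_nonneg_left h5 (sq_nonneg (√p - √p'))]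
    exact le_of_mul_le_mul_right h6 hpos

/-- A query whose answer under `U` is legal for `D` has answer bits that are hard to tell apart. -/
lemma LegalAnswer.le_bernoulliAffinity {t : ℕ} {p p' : ℝ} (hp : p ∈ Set.Icc (0 : ℝ) 1)
    (hp' : p' ∈ Set.Icc (0 : ℝ) 1) (h : LegalAnswer t p' p) :
    1 - 1 / (t : ℝ) ≤ bernoulliAffinity p p' := by
  obtain ⟨hp0, hp1⟩ := hp
  obtain ⟨hp0', hp1'⟩ := hp'
  have ht : (0 : ℝ) ≤ 1 / t := by positivity
  have key : (√p - √p') ^ 2 ≤ 1 / t ∧ (√(1 - p) - √(1 - p')) ^ 2 ≤ 1 / t := by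
    rcases le_max_iff.1 h with h | h
    · refine ⟨(sq_sqrt_sub_sqrt_le_abs hp0 hp0').trans h,
        (sq_sqrt_sub_sqrt_le_abs (by linarith) (by linarith)).trans ?_⟩
      rw [abs_sub_comm]
      convert h using 2
      ring
    · have h' : (p - p') ^ 2 ≤ p' * (1 - p') / t := by
        have hnn : 0 ≤ p' * (1 - p') / t :=
          div_nonneg (mul_nonneg hp0' (by linarith)) (Nat.cast_nonneg _)
        rw [← Real.sq_sqrt hnn, ← sq_abs]
        exact pow_le_pow_left₀ (abs_nonneg _) h 2
      have h'' : (p - p') ^ 2 ≤ p' * (1 - p') * (1 / t) := by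
        rwa [mul_one_div]
      constructor
      · refine sq_sqrt_sub_sqrt_le_of_sq_sub_le hp0 hp0' ht (h''.trans ?_)
        nlinarith [mul_nonneg (mul_nonneg hp0' hp0') ht]
      · refine sq_sqrt_sub_sqrt_le_of_sq_sub_le (by linarith) (by linarith) ht ?_
        have : (1 - p - (1 - p')) ^ 2 = (p - p') ^ 2 := by ring
        rw [this]
        refine h''.trans ?_
        nlinarith [mul_nonneg (mul_nonneg (sub_nonneg.2 hp1') (sub_nonneg.2 hp1')) ht]
  have h1 := Real.sq_sqrt hp0
  have h2 := Real.sq_sqrt hp0'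
  have h3 := Real.sq_sqrt (sub_nonneg.2 hp1)
  have h4 := Real.sq_sqrt (sub_nonneg.2 hp1')
  unfold bernoulliAffinity
  nlinarith [key.1, key.2]

/-- A lower bound on the affinity bounds the total variation distance. -/
lemma sq_sub_le_of_le_bernoulliAffinity {v v' s : ℝ} (hv : v ∈ Set.Icc (0 : ℝ) 1)
    (hv' : v' ∈ Set.Icc (0 : ℝ) 1) (hs : s ≤ 1) (h : 1 - s ≤ bernoulliAffinity v v') :
    (v' - v) ^ 2 ≤ 2 * s := by
  obtain ⟨hv0, hv1⟩ := hv
  obtain ⟨hv0', hv1'⟩ := hv'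
  have h1 := Real.sq_sqrt hv0
  have h2 := Real.sq_sqrt hv0'
  have h3 := Real.sq_sqrt (sub_nonneg.2 hv1)
  have h4 := Real.sq_sqrt (sub_nonneg.2 hv1')
  have n1 := Real.sqrt_nonneg v
  have n2 := Real.sqrt_nonneg v'
  have n3 := Real.sqrt_nonneg (1 - v)
  have n4 := Real.sqrt_nonneg (1 - v')
  unfold bernoulliAffinity at h
  generalize √v = a at *
  generalize √v' = c at *
  generalize √(1 - v) = b at *
  generalize √(1 - v') = d at *
  have hab : a ^ 2 + b ^ 2 = 1 := by linarith
  have hcd : c ^ 2 + d ^ 2 = 1 := by linarith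
  have e : v' - v = (b * c - a * d) * (b * c + a * d) := by
    rw [← h1, ← h2]
    linear_combination (-c ^ 2) * hab + a ^ 2 * hcd
  have e2 : (b * c - a * d) ^ 2 = 1 - (a * c + b * d) ^ 2 := by
    linear_combination (c ^ 2 + d ^ 2) * hab + hcd
  have e3 : (b * c + a * d) ^ 2 ≤ 1 := by
    have : (b * c + a * d) ^ 2 = 1 - (a * c - b * d) ^ 2 := by
      linear_combination (c ^ 2 + d ^ 2) * hab + hcd
    nlinarith [sq_nonneg (a * c - b * d)]
  have e4 : (1 - s) ^ 2 ≤ (a * c + b * d) ^ 2 := pow_le_pow_left₀ (by linarith) h 2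
  calc (v' - v) ^ 2 = (b * c - a * d) ^ 2 * (b * c + a * d) ^ 2 := by rw [e]; ring
    _ ≤ (b * c - a * d) ^ 2 * 1 := mul_le_mul_of_nonneg_left e3 (sq_nonneg _)
    _ ≤ 2 * s := by nlinarith [sq_nonneg s]

/-! ### Lower bounds for algorithms with one-bit sample access -/

namespace StatAlg

open Classical in
/-- The algorithm that stops with the verdict `true` as soon as it is about to make a query
from `bad`. -/
noncomputable def cut (bad : (X → Bool) → Prop) : StatAlg X Bool → StatAlg X Bool
  | output b => output b
  | call f hf next => if bad f then output true else call f hf fun a => cut bad (next a)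

lemma verdictProb_add (D : Measure X) [IsProbabilityMeasure D] (alg : StatAlg X Bool) :
    alg.verdictProb D true + alg.verdictProb D false = 1 := by
  induction alg with
  | output b => cases b <;> simp [verdictProb]
  | call f hf next ih =>
    have h1 : D {x | f x = true} + D {x | f x = false} = 1 := by
      rw [setOf_eq_false, measure_add_measure_compl (measurableSet_eq_true hf), measure_univ]
    simp only [verdictProb]
    calc _ = D {x | f x = true} *
            ((next true).verdictProb D true + (next true).verdictProb D false) +
          D {x | f x = false} *
            ((next false).verdictProb D true + (next false).verdictProb D false) := by ring
      _ = 1 := by rw [ih, ih, mul_one, mul_one, h1]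

lemma verdictProb_le_one (D : Measure X) [IsProbabilityMeasure D] (alg : StatAlg X Bool) :
    alg.verdictProb D true ≤ 1 :=
  le_self_add.trans_eq (verdictProb_add D alg)

lemma verdictProb_le_cut (D : Measure X) [IsProbabilityMeasure D] (bad : (X → Bool) → Prop)
    (alg : StatAlg X Bool) : alg.verdictProb D true ≤ (alg.cut bad).verdictProb D true := by
  induction alg with
  | output b => rfl
  | call f hf next ih =>
    rw [cut]
    split_ifs with h
    · exact (verdictProb_le_one D _).trans (by simp [verdictProb])
    · exact add_le_add (mul_le_mul_right (ih _) _) (mul_le_mul_right (ih _) _)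

lemma toReal_verdictProb_mem_Icc (D : Measure X) [IsProbabilityMeasure D] (alg : StatAlg X Bool) :
    (alg.verdictProb D true).toReal ∈ Set.Icc (0 : ℝ) 1 :=
  ⟨ENNReal.toReal_nonneg, ENNReal.toReal_le_of_le_ofReal zero_le_one
    (by simpa using verdictProb_le_one D alg)⟩

lemma toReal_verdictProb_call (D : Measure X) [IsProbabilityMeasure D] (f : X → Bool)
    (hf : Measurable f) (next : Bool → StatAlg X Bool) :
    ((call f hf next).verdictProb D true).toReal =
      queryMean D f * ((next true).verdictProb D true).toReal +
        (1 - queryMean D f) * ((next false).verdictProb D true).toReal := by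
  have h1 : (D {x | f x = false}).toReal = 1 - queryMean D f := by
    rw [setOf_eq_false, queryMean, ← probReal_compl_eq_one_sub (measurableSet_eq_true hf)]
    rfl
  have hfin : ∀ a, (next a).verdictProb D true ≠ ∞ := fun a =>
    ((verdictProb_le_one D _).trans_lt ENNReal.one_lt_top).ne
  rw [verdictProb, ENNReal.toReal_add (ENNReal.mul_ne_top (measure_ne_top _ _) (hfin _))
    (ENNReal.mul_ne_top (measure_ne_top _ _) (hfin _)), ENNReal.toReal_mul, ENNReal.toReal_mul, h1]
  rfl

lemma queryMean_mem_Icc (D : Measure X) [IsProbabilityMeasure D] (f : X → Bool) :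
    queryMean D f ∈ Set.Icc (0 : ℝ) 1 := ⟨measureReal_nonneg, measureReal_le_one⟩

/-- Affinities multiply along the queries of an adaptive algorithm, as long as it stops before
the queries that distinguish `D` from `U`. -/
lemma pow_le_bernoulliAffinity_cut {U D : Measure X} [IsProbabilityMeasure U]
    [IsProbabilityMeasure D] {t : ℕ} (ht : 1 ≤ t) (alg : StatAlg X Bool) (q : ℕ)
    (hq : alg.MakesAtMost q) :
    (1 - 1 / (t : ℝ)) ^ q ≤ bernoulliAffinity
      ((alg.cut fun f => ¬ LegalAnswer t (queryMean D f) (queryMean U f)).verdictProb U true).toReal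
      ((alg.cut fun f =>
        ¬ LegalAnswer t (queryMean D f) (queryMean U f)).verdictProb D true).toReal := by
  have hr1 : (1 - 1 / (t : ℝ)) ≤ 1 := by linarith [show (0 : ℝ) ≤ 1 / t by positivity]
  have hr0 : 0 ≤ (1 - 1 / (t : ℝ)) := by
    have : 1 / (t : ℝ) ≤ 1 := by
      rw [div_le_one (by exact_mod_cast ht)]
      exact_mod_cast ht
    linarith
  induction alg generalizing q with
  | output b =>
    refine (pow_le_one₀ hr0 hr1).trans ?_
    cases b <;> simp [cut, verdictProb, bernoulliAffinity]
  | call f hf next ih =>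
    cases q with
    | zero => exact hq.elim
    | succ q =>
      rw [cut]
      by_cases h : LegalAnswer t (queryMean D f) (queryMean U f)
      swap
      · rw [if_pos h]
        refine (pow_le_one₀ hr0 hr1).trans ?_
        simp [verdictProb, bernoulliAffinity]
      · rw [if_neg (not_not.2 h)]
        rw [toReal_verdictProb_call, toReal_verdictProb_call]
        refine le_trans ?_ (bernoulliAffinity_mixture_le (queryMean_mem_Icc U f)
          (queryMean_mem_Icc D f) (toReal_verdictProb_mem_Icc _ _)
          (toReal_verdictProb_mem_Icc _ _) (toReal_verdictProb_mem_Icc _ _)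
          (toReal_verdictProb_mem_Icc _ _))
        have h1 := h.le_bernoulliAffinity (queryMean_mem_Icc U f) (queryMean_mem_Icc D f)
        calc (1 - 1 / (t : ℝ)) ^ (q + 1)
            ≤ bernoulliAffinity (queryMean U f) (queryMean D f) * (1 - 1 / (t : ℝ)) ^ q := by
              rw [pow_succ']
              exact mul_le_mul_of_nonneg_right h1 (pow_nonneg hr0 _)
          _ ≤ _ := by
              rw [bernoulliAffinity, add_mul]
              exact add_le_add
                (mul_le_mul_of_nonneg_left (ih _ q (hq _)) (by positivity))
                (mul_le_mul_of_nonneg_left (ih _ q (hq _)) (by positivity))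

/-- On `U`, cutting at the distinguishing queries changes the verdict for few indices on average: it
does so only on the paths that meet a query distinguishing the index. -/
lemma sum_verdictProb_cut_le {U : Measure X} [IsProbabilityMeasure U] {D : ι → Measure X} {t : ℕ}
    {I : Finset ι} {β : ℝ≥0∞}
    (hβ : ∀ f, Measurable f → ((distinguished U D t I f).card : ℝ≥0∞) ≤ β)
    (alg : StatAlg X Bool) (q : ℕ) (hq : alg.MakesAtMost q) :
    ∑ i ∈ I, (alg.cut fun f =>
        ¬ LegalAnswer t (queryMean (D i) f) (queryMean U f)).verdictProb U true ≤
      I.card * alg.verdictProb U true + q * β := by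
  classical
  induction alg generalizing q with
  | output b => simp [cut, verdictProb]
  | call f hf next ih =>
    cases q with
    | zero => exact hq.elim
    | succ q =>
      have h1 : U {x | f x = true} + U {x | f x = false} = 1 := by
        rw [setOf_eq_false, measure_add_measure_compl (measurableSet_eq_true hf), measure_univ]
      set s : Bool → ι → ℝ≥0∞ := fun a i => ((next a).cut fun f =>
        ¬ LegalAnswer t (queryMean (D i) f) (queryMean U f)).verdictProb U true with hs
      calc _ ≤ ∑ i ∈ I, ((if ¬ LegalAnswer t (queryMean (D i) f) (queryMean U f) then 1 else 0) +
              (U {x | f x = true} * s true i + U {x | f x = false} * s false i)) := by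
            refine Finset.sum_le_sum fun i _ => ?_
            rw [cut]
            by_cases h : LegalAnswer t (queryMean (D i) f) (queryMean U f)
            · simp [verdictProb, hs, h]
            · simp [verdictProb, h]
        _ = (distinguished U D t I f).card +
            (U {x | f x = true} * ∑ i ∈ I, s true i +
              U {x | f x = false} * ∑ i ∈ I, s false i) := by
            rw [Finset.sum_add_distrib, Finset.sum_add_distrib, ← Finset.mul_sum, ← Finset.mul_sum,
              distinguished, Finset.card_filter]
            push_cast
            rfl
        _ ≤ β + (U {x | f x = true} * (I.card * (next true).verdictProb U true + q * β) +
              U {x | f x = false} * (I.card * (next false).verdictProb U true + q * β)) := by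
            gcongr
            · exact hβ f hf
            · exact ih _ q (hq _)
            · exact ih _ q (hq _)
        _ = β + (I.card * (U {x | f x = true} * (next true).verdictProb U true +
              U {x | f x = false} * (next false).verdictProb U true) +
              (U {x | f x = true} + U {x | f x = false}) * (q * β)) := by ring
        _ = _ := by
            rw [h1, verdictProb]
            push_cast
            ring

end StatAlg

/-- No measurability is needed in this direction, as the integrals are lower integrals. -/
lemma sum_lintegral_le_lintegral_sum {Ω : Type} [MeasurableSpace Ω] (P : Measure Ω)
    (I : Finset ι) (F : ι → Ω → ℝ≥0∞) :
    ∑ i ∈ I, ∫⁻ ω, F i ω ∂P ≤ ∫⁻ ω, ∑ i ∈ I, F i ω ∂P := by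
  classical
  induction I using Finset.induction_on with
  | empty => simp
  | insert a s ha ih =>
    simp only [Finset.sum_insert ha]
    exact (add_le_add_right ih _).trans (le_lintegral_add _ _)

/-- If every query distinguishes at most a fraction `1/N ≤ 8/t` of the plantings, detection needs
`t/32` calls to `1-STAT`. -/
theorem needsOneSTATCalls_of_card_distinguished_le {U : Measure X} [IsProbabilityMeasure U]
    {D : ι → Measure X} (hprob : ∀ i, IsProbabilityMeasure (D i)) {t : ℕ}
    {I : Finset ι} {𝒟 : Set (Measure X)} {N : ℝ} (hI : I.Nonempty) (hN : 0 < N) (ht : 1 ≤ t)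
    (hNt : (t : ℝ) / 8 ≤ N) (hD : ∀ i ∈ I, D i ∈ 𝒟)
    (hcard : ∀ f, Measurable f → ((distinguished U D t I f).card : ℝ) ≤ I.card / N) :
    NeedsOneSTATCalls U 𝒟 (t / 32) := by
  intro Ω _ P _ alg q hq hsol
  by_contra! hlt
  have hIpos : (0 : ℝ) < I.card := by exact_mod_cast hI.card_pos
  have htpos : (0 : ℝ) < t := by exact_mod_cast ht
  have hqt : (q : ℝ) / t < 1 / 32 := by
    rw [div_lt_iff₀ htpos]
    linarith
  have hqN : (q : ℝ) / N < 1 / 4 := by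
    rw [div_lt_iff₀ hN]
    linarith
  -- cutting can only raise the probability of the verdict `true` under `D i`, and the cut algorithm
  -- behaves almost alike under `D i` and `U`
  have htv : ∀ (i : ι) (ω : Ω), (alg ω).verdictProb (D i) true ≤
      ((alg ω).cut fun f =>
        ¬ LegalAnswer t (queryMean (D i) f) (queryMean U f)).verdictProb U true +
        ENNReal.ofReal (1 / 4) := by
    intro i ω
    have := hprob i
    refine ((alg ω).verdictProb_le_cut (D i)
      fun f => ¬ LegalAnswer t (queryMean (D i) f) (queryMean U f)).trans ?_
    set A := (alg ω).cut fun f => ¬ LegalAnswer t (queryMean (D i) f) (queryMean U f) with hA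
    have h1 := StatAlg.pow_le_bernoulliAffinity_cut (U := U) (D := D i) ht (alg ω) q (hq ω)
    rw [← hA] at h1
    have hb : -2 ≤ -(1 / (t : ℝ)) := by
      have : 1 / (t : ℝ) ≤ 1 := by
        rw [div_le_one htpos]
        exact_mod_cast ht
      linarith
    have h2 : 1 - (q : ℝ) / t ≤ (1 - 1 / (t : ℝ)) ^ q := by
      have := one_add_mul_le_pow hb q
      rw [← sub_eq_add_neg] at this
      refine le_trans (le_of_eq ?_) this
      ring
    have h3 := sq_sub_le_of_le_bernoulliAffinity (StatAlg.toReal_verdictProb_mem_Icc U A)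
      (StatAlg.toReal_verdictProb_mem_Icc (D i) A) (by linarith) (h2.trans h1)
    have h4 : (A.verdictProb (D i) true).toReal ≤ (A.verdictProb U true).toReal + 1 / 4 := by
      nlinarith
    rw [← ENNReal.ofReal_toReal
        ((StatAlg.verdictProb_le_one (D i) A).trans_lt ENNReal.one_lt_top).ne,
      ← ENNReal.ofReal_toReal ((StatAlg.verdictProb_le_one U A).trans_lt ENNReal.one_lt_top).ne,
      ← ENNReal.ofReal_add ENNReal.toReal_nonneg (by norm_num)]
    exact ENNReal.ofReal_le_ofReal h4
  have hcard' : ∀ f, Measurable f →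
      ((distinguished U D t I f).card : ℝ≥0∞) ≤ ENNReal.ofReal (I.card / N) := by
    intro f hf
    rw [← ENNReal.ofReal_natCast]
    exact ENNReal.ofReal_le_ofReal (hcard f hf)
  have hpt : ∀ ω, ∑ i ∈ I, ((alg ω).verdictProb (D i) true + (alg ω).verdictProb U false) ≤
      ENNReal.ofReal (I.card * (1 + 1 / 4 + q / N)) := by
    intro ω
    calc _ ≤ ∑ i ∈ I, ((((alg ω).cut fun f =>
            ¬ LegalAnswer t (queryMean (D i) f) (queryMean U f)).verdictProb U true +
            ENNReal.ofReal (1 / 4)) + (alg ω).verdictProb U false) := by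
          gcongr with i _
          exact htv i ω
      _ = ∑ i ∈ I, ((alg ω).cut fun f =>
            ¬ LegalAnswer t (queryMean (D i) f) (queryMean U f)).verdictProb U true +
            I.card * ENNReal.ofReal (1 / 4) + I.card * (alg ω).verdictProb U false := by
          simp [Finset.sum_add_distrib]
      _ ≤ (I.card * (alg ω).verdictProb U true + q * ENNReal.ofReal (I.card / N)) +
            I.card * ENNReal.ofReal (1 / 4) + I.card * (alg ω).verdictProb U false := by
          gcongr
          exact StatAlg.sum_verdictProb_cut_le hcard' (alg ω) q (hq ω)
      _ = I.card * ((alg ω).verdictProb U true + (alg ω).verdictProb U false) +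
            I.card * ENNReal.ofReal (1 / 4) + q * ENNReal.ofReal (I.card / N) := by ring
      _ = _ := by
          rw [StatAlg.verdictProb_add, mul_one, ← ENNReal.ofReal_natCast, ← ENNReal.ofReal_natCast,
            ← ENNReal.ofReal_mul (by positivity), ← ENNReal.ofReal_mul (by positivity),
            ← ENNReal.ofReal_add (by positivity) (by positivity),
            ← ENNReal.ofReal_add (by positivity) (by positivity)]
          congr 1
          ring
  have hlow : ENNReal.ofReal (I.card * (3 / 2)) ≤
      ENNReal.ofReal (I.card * (1 + 1 / 4 + q / N)) := by
    calc ENNReal.ofReal (I.card * (3 / 2)) = ∑ i ∈ I, (3 / 4 + 3 / 4 : ℝ≥0∞) := by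
          rw [ENNReal.ofReal_mul (by positivity), Finset.sum_const, nsmul_eq_mul,
            ENNReal.ofReal_natCast, ENNReal.div_add_div_same]
          congr 1
          rw [ENNReal.ofReal_div_of_pos (by norm_num), ENNReal.div_eq_div_iff] <;> norm_num
      _ ≤ ∑ i ∈ I, (∫⁻ ω, (alg ω).verdictProb (D i) true ∂P +
            ∫⁻ ω, (alg ω).verdictProb U false ∂P) :=
          Finset.sum_le_sum fun i hi => add_le_add (hsol.2 _ (hD i hi)) hsol.1
      _ ≤ ∑ i ∈ I, ∫⁻ ω, ((alg ω).verdictProb (D i) true + (alg ω).verdictProb U false) ∂P :=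
          Finset.sum_le_sum fun i _ => le_lintegral_add _ _
      _ ≤ ∫⁻ ω, ∑ i ∈ I, ((alg ω).verdictProb (D i) true + (alg ω).verdictProb U false) ∂P :=
          sum_lintegral_le_lintegral_sum P I _
      _ ≤ ∫⁻ _, ENNReal.ofReal (I.card * (1 + 1 / 4 + q / N)) ∂P := lintegral_mono hpt
      _ = _ := by simp
  rw [ENNReal.ofReal_le_ofReal_iff (by positivity)] at hlow
  have := le_of_mul_le_mul_left hlow hIpos
  linarith

end Queries

/-! ### Few plantings are distinguished if their densities are nearly uncorrelated -/

/-- The correlation of the densities `g` and `h` relative to `U`: the inner product of `g - 1` and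
`h - 1`. It is also used for densities of total mass below one. -/
noncomputable def densityCorrelation {X : Type} [MeasurableSpace X] (U : Measure X) (g h : X → ℝ) :
    ℝ :=
  ∫ x, (g x - 1) * (h x - 1) ∂U

section Correlation

variable {X ι : Type} [MeasurableSpace X]

lemma sq_setIntegral_le {U : Measure X} [IsFiniteMeasure U] {E : Set X} (hE : MeasurableSet E)
    {g : X → ℝ} (hg : MemLp g 2 U) : (∫ x in E, g x ∂U) ^ 2 ≤ U.real E * ∫ x, g x ^ 2 ∂U := by
  have hgi : Integrable g U := hg.integrable (by norm_num)
  have hg2 : Integrable (fun x => g x ^ 2) U := hg.integrable_sq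
  set J := ∫ x in E, g x ∂U with hJ
  -- the quadratic polynomial `s ↦ ∫ (g - s 1_E)²` is nonnegative
  have hquad : ∀ s : ℝ, 0 ≤ U.real E * (s * s) + (-2 * J) * s + ∫ x, g x ^ 2 ∂U := by
    intro s
    have h0 : 0 ≤ ∫ x, (g x - s * E.indicator 1 x) ^ 2 ∂U := integral_nonneg fun x => sq_nonneg _
    have e : ∀ x, (g x - s * E.indicator 1 x) ^ 2 =
        g x ^ 2 + ((-2 * s) * E.indicator g x + s * s * E.indicator 1 x) := by
      intro x
      by_cases hx : x ∈ E <;> simp [hx]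
      ring
    have i1 : Integrable (fun x => (-2 * s) * E.indicator g x) U :=
      (hgi.indicator hE).const_mul _
    have i2 : Integrable (fun x => s * s * E.indicator (1 : X → ℝ) x) U :=
      ((integrable_const (1 : ℝ)).indicator hE).const_mul _
    have i3 : Integrable (fun x => (-2 * s) * E.indicator g x +
        s * s * E.indicator (1 : X → ℝ) x) U := i1.add i2
    simp_rw [e] at h0
    rw [integral_add hg2 i3, integral_add i1 i2, integral_const_mul, integral_const_mul,
      integral_indicator hE, integral_indicator_one hE, ← hJ] at h0
    linarith
  have := discrim_le_zero hquad
  unfold discrim at this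
  linarith

lemma sq_sum_setIntegral_sub_le {U : Measure X} [IsProbabilityMeasure U] {E : Set X}
    (hE : MeasurableSet E) {h : ι → X → ℝ} (hh : ∀ i, MemLp (h i) 2 U) (A : Finset ι) :
    (∑ i ∈ A, (∫ x in E, h i x ∂U - U.real E)) ^ 2 ≤
      U.real E * ∑ i ∈ A, ∑ j ∈ A, densityCorrelation U (h i) (h j) := by
  have hm : ∀ i, MemLp (fun x => h i x - 1) 2 U := fun i => (hh i).sub (memLp_const 1)
  have hsum : MemLp (fun x => ∑ i ∈ A, (h i x - 1)) 2 U := memLp_finsetSum A fun i _ => hm i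
  have h1 := sq_setIntegral_le hE hsum
  have e1 : ∫ x in E, ∑ i ∈ A, (h i x - 1) ∂U = ∑ i ∈ A, (∫ x in E, h i x ∂U - U.real E) := by
    rw [integral_finsetSum _ fun i _ => ((hm i).integrable (by norm_num)).integrableOn]
    refine Finset.sum_congr rfl fun i _ => ?_
    rw [integral_sub ((hh i).integrable (by norm_num)).integrableOn
      (integrable_const 1).integrableOn]
    simp
  have e2 : ∫ x, (∑ i ∈ A, (h i x - 1)) ^ 2 ∂U =
      ∑ i ∈ A, ∑ j ∈ A, densityCorrelation U (h i) (h j) := by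
    have hij : ∀ i j, Integrable (fun x => (h i x - 1) * (h j x - 1)) U := fun i j =>
      (hm i).integrable_mul (hm j)
    simp_rw [sq, Finset.sum_mul_sum]
    rw [integral_finsetSum _ fun i _ => integrable_finsetSum _ fun j _ => hij i j]
    refine Finset.sum_congr rfl fun i _ => ?_
    rw [integral_finsetSum _ fun j _ => hij i j]
    rfl
  rwa [e1, e2] at h1

lemma legalAnswer_one_sub {t : ℕ} {p y : ℝ} :
    LegalAnswer t (1 - p) (1 - y) ↔ LegalAnswer t p y := by
  unfold LegalAnswer
  rw [show 1 - y - (1 - p) = p - y by ring, abs_sub_comm,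
    show (1 - p) * (1 - (1 - p)) = p * (1 - p) by ring]

/-- An illegal answer `p ≤ 1/2` is off by at least the order of `√(p/t)`, whatever the true
expectation. -/
lemma div_le_sq_sub_of_not_legalAnswer {t : ℕ} (ht : 1 ≤ t) {p y : ℝ} (hy : 0 ≤ y)
    (hy2 : y ≤ 1 / 2) (hp : 0 ≤ p) (h : ¬ LegalAnswer t p y) :
    1 / (t : ℝ) < |y - p| ∧ y / (8 * t) ≤ (y - p) ^ 2 := by
  have htpos : (0 : ℝ) < t := by exact_mod_cast ht
  have ht1 : (1 : ℝ) ≤ t := by exact_mod_cast ht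
  unfold LegalAnswer at h
  rw [not_le, max_lt_iff] at h
  obtain ⟨h1, h2⟩ := h
  refine ⟨h1, ?_⟩
  have h3 : p * (1 - p) / t < (y - p) ^ 2 := by
    rw [← sq_abs]
    exact (Real.sqrt_lt' ((by positivity : (0 : ℝ) < 1 / t).trans h1)).1 h2
  rw [div_lt_iff₀ htpos] at h3
  rw [div_le_iff₀ (by positivity)]
  rcases lt_or_ge p (y / 2) with hpy | hpy
  · rw [abs_of_nonneg (by linarith), div_lt_iff₀ htpos] at h1
    have h4 : y / 2 ≤ y - p := by linarith
    have : 1 ≤ y * t := by nlinarith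
    nlinarith [mul_le_mul h4 h4 (by linarith) (by linarith)]
  · rcases le_or_gt p (3 / 4) with hp4 | hp4
    · nlinarith
    · have h4 : 1 / 4 ≤ p - y := by linarith
      have h5 : (1 / 16 : ℝ) ≤ (y - p) ^ 2 := by nlinarith
      nlinarith

/-- The bound on the distinguished plantings for queries of expectation at most `1/2`. -/
lemma card_distinguished_le_of_queryMean_le_half {U : Measure X} [IsProbabilityMeasure U]
    {D : ι → Measure X} (hprob : ∀ i, IsProbabilityMeasure (D i)) {t : ℕ} (ht : 1 ≤ t)
    {I : Finset ι} {h : ι → X → ℝ} (hh : ∀ i, MemLp (h i) 2 U)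
    (hle : ∀ i ∈ I, ∀ E, MeasurableSet E → ∫ x in E, h i x ∂U ≤ (D i).real E)
    (hmass : ∀ i ∈ I, 1 - ∫ x, h i x ∂U ≤ 1 / (2 * t))
    {a b : ℝ} (ha : a ≤ 1 / (64 * t))
    (hcorr : ∀ A ⊆ I,
      ∑ i ∈ A, ∑ j ∈ A, densityCorrelation U (h i) (h j) ≤ A.card * (A.card * a + b))
    (hb : 0 ≤ b) {f : X → Bool} (hf : Measurable f) (hf2 : queryMean U f ≤ 1 / 2) :
    ((distinguished U D t I f).card : ℝ) ≤ 128 * t * b := by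
  classical
  have htpos : (0 : ℝ) < t := by exact_mod_cast ht
  set E : Set X := {x | f x = true} with hE
  have hEm : MeasurableSet E := measurableSet_eq_true hf
  set p := queryMean U f with hp
  have hp0 : 0 ≤ p := measureReal_nonneg
  set r : ι → ℝ := fun i => ∫ x in E, h i x ∂U with hr
  -- the truncated densities see at least half of the deviation
  have hdev : ∀ i ∈ distinguished U D t I f, 0 < |r i - p| ∧ √(p / (32 * t)) ≤ |r i - p| := by
    intro i hi
    have hi' := (Finset.mem_filter.1 hi)
    have := hprob i
    obtain ⟨h1, h2⟩ := div_le_sq_sub_of_not_legalAnswer ht hp0 hf2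
      (StatAlg.queryMean_mem_Icc (D i) f).1 hi'.2
    have h3 : r i ≤ queryMean (D i) f := hle i hi'.1 E hEm
    have h4 : queryMean (D i) f ≤ r i + 1 / (2 * t) := by
      have h5 := hle i hi'.1 Eᶜ hEm.compl
      rw [probReal_compl_eq_one_sub hEm] at h5
      have h6 := integral_add_compl hEm ((hh i).integrable (by norm_num))
      have h7 := hmass i hi'.1
      change (D i).real E ≤ _
      simp only [hr]
      linarith
    have h8 : |queryMean (D i) f - r i| ≤ 1 / (2 * t) := by
      rw [abs_of_nonneg (by linarith)]
      linarith
    have h9 : |p - queryMean (D i) f| ≤ |r i - p| + |queryMean (D i) f - r i| := by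
      rw [abs_sub_comm p]
      have := abs_add_le (r i - p) (queryMean (D i) f - r i)
      rw [show r i - p + (queryMean (D i) f - r i) = queryMean (D i) f - p by ring] at this
      linarith
    have h10 : 1 / (2 * (t : ℝ)) = 1 / t / 2 := by rw [div_div, mul_comm]
    have h11 : |p - queryMean (D i) f| / 2 ≤ |r i - p| := by linarith
    refine ⟨by linarith [show (0 : ℝ) < 1 / t by positivity], ?_⟩
    rw [Real.sqrt_le_left (abs_nonneg _)]
    calc p / (32 * t) = p / (8 * t) / 4 := by
          field_simp
          ring
      _ ≤ (p - queryMean (D i) f) ^ 2 / 4 := by linarith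
      _ = (|p - queryMean (D i) f| / 2) ^ 2 := by rw [div_pow, sq_abs]; norm_num
      _ ≤ |r i - p| ^ 2 := pow_le_pow_left₀ (by positivity) h11 2
  -- all deviations in `A` have the same sign `ε`
  have hsign : ∀ A ⊆ distinguished U D t I f, ∀ ε : ℝ, ε ^ 2 = 1 →
      (∀ i ∈ A, ε * (r i - p) = |r i - p|) → (A.card : ℝ) ≤ 64 * t * b := by
    intro A hA ε hε hεA
    rcases A.eq_empty_or_nonempty with rfl | ⟨i₀, hi₀⟩
    · simp
      positivity
    have hcard : (0 : ℝ) < A.card := by exact_mod_cast Finset.card_pos.2 ⟨i₀, hi₀⟩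
    have hppos : 0 < p := by
      refine hp0.lt_of_ne fun h0 => ?_
      have hU : U E = 0 := by
        have : U.real E = 0 := h0.symm
        rwa [measureReal_eq_zero_iff] at this
      have h1 := (hdev i₀ (hA hi₀)).1
      simp [hr, setIntegral_measure_zero _ hU, ← h0] at h1
    have hAI : A ⊆ I := hA.trans (Finset.filter_subset _ _)
    have h1 : A.card * √(p / (32 * t)) ≤ ε * ∑ i ∈ A, (r i - p) := by
      rw [Finset.mul_sum, ← nsmul_eq_mul]
      refine Finset.card_nsmul_le_sum _ _ _ fun i hi => ?_
      rw [hεA i hi]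
      exact (hdev i (hA hi)).2
    have h2 : (A.card * √(p / (32 * t))) ^ 2 ≤ (∑ i ∈ A, (r i - p)) ^ 2 := by
      refine (pow_le_pow_left₀ (by positivity) h1 2).trans (le_of_eq ?_)
      rw [mul_pow, hε, one_mul]
    have h3 := (h2.trans (sq_sum_setIntegral_sub_le hEm hh A)).trans
      (mul_le_mul_of_nonneg_left (hcorr A hAI) hp0)
    rw [mul_pow, Real.sq_sqrt (by positivity), show U.real E = p from rfl] at h3
    have h4 : (p * A.card) * (A.card / (32 * t)) ≤ (p * A.card) * (A.card * a + b) := by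
      calc _ = (A.card : ℝ) ^ 2 * (p / (32 * t)) := by ring
        _ ≤ _ := h3
        _ = _ := by ring
    have h5 := le_of_mul_le_mul_left h4 (by positivity)
    have h6 : A.card * a ≤ A.card * (1 / (64 * t)) := mul_le_mul_of_nonneg_left ha hcard.le
    have h7 : (A.card : ℝ) / (32 * t) = 2 * (A.card * (1 / (64 * t))) := by
      field_simp
      norm_num
    have h8 : A.card * (1 / (64 * t)) ≤ b := by linarith
    rw [mul_one_div, div_le_iff₀ (by positivity)] at h8
    linarith
  have hpos := hsign {i ∈ distinguished U D t I f | 0 ≤ r i - p} (Finset.filter_subset _ _) 1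
    (by norm_num) fun i hi => by rw [one_mul, abs_of_nonneg (Finset.mem_filter.1 hi).2]
  have hneg := hsign {i ∈ distinguished U D t I f | ¬ 0 ≤ r i - p} (Finset.filter_subset _ _) (-1)
    (by norm_num) fun i hi => by
      rw [abs_of_neg (not_le.1 (Finset.mem_filter.1 hi).2), neg_one_mul]
  rw [← Finset.card_filter_add_card_filter_not (s := distinguished U D t I f)
    (fun i => 0 ≤ r i - p)]
  push_cast
  linarith

/-- If the correlations of the (truncated) densities `h i ≤ dD i / dU` are small on average over
every large enough set of plantings, then every query distinguishes few plantings. -/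
theorem card_distinguished_le {U : Measure X} [IsProbabilityMeasure U]
    {D : ι → Measure X} (hprob : ∀ i, IsProbabilityMeasure (D i)) {t : ℕ} (ht : 1 ≤ t)
    {I : Finset ι} {h : ι → X → ℝ} (hh : ∀ i, MemLp (h i) 2 U)
    (hle : ∀ i ∈ I, ∀ E, MeasurableSet E → ∫ x in E, h i x ∂U ≤ (D i).real E)
    (hmass : ∀ i ∈ I, 1 - ∫ x, h i x ∂U ≤ 1 / (2 * t))
    {a b : ℝ} (ha : a ≤ 1 / (64 * t))
    (hcorr : ∀ A ⊆ I,
      ∑ i ∈ A, ∑ j ∈ A, densityCorrelation U (h i) (h j) ≤ A.card * (A.card * a + b))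
    (hb : 0 ≤ b) {f : X → Bool} (hf : Measurable f) :
    ((distinguished U D t I f).card : ℝ) ≤ 128 * t * b := by
  rcases le_total (queryMean U f) (1 / 2) with hf2 | hf2
  · exact card_distinguished_le_of_queryMean_le_half hprob ht hh hle hmass ha hcorr hb hf hf2
  · -- the complementary query distinguishes the same plantings
    have hf' : Measurable fun x => !(f x) := (measurable_of_finite not).comp hf
    have hmean : ∀ (M : Measure X) [IsProbabilityMeasure M],
        queryMean M (fun x => !(f x)) = 1 - queryMean M f := by
      intro M _
      rw [queryMean, queryMean, ← probReal_compl_eq_one_sub (measurableSet_eq_true hf),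
        ← setOf_eq_false]
      simp
    have hdist : distinguished U D t I f = distinguished U D t I fun x => !(f x) := by
      ext i
      have := hprob i
      simp only [distinguished, Finset.mem_filter, hmean U, hmean (D i), legalAnswer_one_sub]
    rw [hdist]
    exact card_distinguished_le_of_queryMean_le_half hprob ht hh hle hmass ha hcorr hb hf'
      (by rw [hmean U]; linarith)

end Correlation

/-! ### The intersection of two random plantings -/

section Combinatorics

lemma choose_sub_mul_pow_le {n k : ℕ} (hkn : k ≤ n) (r : ℕ) (hr : r ≤ k) :
    (n - r).choose (k - r) * n ^ r ≤ n.choose k * k ^ r := by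
  induction r with
  | zero => simp
  | succ r ih =>
    have h1 := ih (by omega)
    have h2 : (n - r) * (n - (r + 1)).choose (k - (r + 1)) = (n - r).choose (k - r) * (k - r) := by
      have := Nat.add_one_mul_choose_eq (n - (r + 1)) (k - (r + 1))
      rwa [show n - (r + 1) + 1 = n - r by omega, show k - (r + 1) + 1 = k - r by omega] at this
    have h3 : (k - r) * n ≤ k * (n - r) := by
      rw [Nat.sub_mul, Nat.mul_sub]
      have : r * k ≤ r * n := Nat.mul_le_mul_left r hkn
      rw [mul_comm k r]
      omega
    have hpos : 0 < n - r := by omega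
    refine Nat.le_of_mul_le_mul_left ?_ hpos
    calc (n - r) * ((n - (r + 1)).choose (k - (r + 1)) * n ^ (r + 1))
        = ((n - r) * (n - (r + 1)).choose (k - (r + 1))) * n ^ r * n := by ring
      _ = ((n - r).choose (k - r) * n ^ r) * ((k - r) * n) := by rw [h2]; ring
      _ ≤ (n.choose k * k ^ r) * (k * (n - r)) := Nat.mul_le_mul h1 h3
      _ = _ := by ring

/-- The exponential moments of the size of the intersection of a fixed set with a random set of
size `k`. -/
lemma sum_pow_card_inter_le {n k : ℕ} (hkn : k ≤ n) (S : Finset (Fin n)) (hS : S.card = k)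
    {Z : ℝ} (hZ : 1 ≤ Z) :
    ∑ T ∈ Finset.powersetCard k Finset.univ, Z ^ (S ∩ T).card ≤
      n.choose k * Real.exp (Z * (k ^ 2 / n)) := by
  -- expanding `Z = (Z - 1) + 1` reduces the moment to the probabilities of `R ⊆ T`
  have hexp : ∀ T : Finset (Fin n), Z ^ (S ∩ T).card =
      ∑ R ∈ S.powerset, if R ⊆ T then (Z - 1) ^ R.card else 0 := by
    intro T
    have h1 := Finset.sum_pow_mul_eq_add_pow (Z - 1) 1 (S ∩ T)
    simp only [one_pow, mul_one, sub_add_cancel] at h1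
    rw [← h1, ← Finset.sum_filter]
    refine Finset.sum_congr ?_ fun _ _ => rfl
    ext R
    simp only [Finset.mem_powerset, Finset.mem_filter, Finset.subset_inter_iff]
  have hcount : ∀ R ∈ S.powerset,
      (({T ∈ Finset.powersetCard k (Finset.univ : Finset (Fin n)) | R ⊆ T} :
        Finset (Finset (Fin n))).card : ℝ) ≤ n.choose k * ((k : ℝ) / n) ^ R.card := by
    intro R hR
    have hRk : R.card ≤ k := hS ▸ Finset.card_le_card (Finset.mem_powerset.1 hR)
    rw [Finset.card_filter_powersetCard_subset _ _ _ (Finset.subset_univ R) hRk, Finset.card_univ,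
      Fintype.card_fin, div_pow, ← mul_div_assoc]
    rcases Nat.eq_zero_or_pos n with rfl | hn
    · have hk : k = 0 := by omega
      subst hk
      have : R.card = 0 := by omega
      simp [this]
    rw [le_div_iff₀ (by positivity)]
    exact_mod_cast choose_sub_mul_pow_le hkn R.card hRk
  calc ∑ T ∈ Finset.powersetCard k Finset.univ, Z ^ (S ∩ T).card
      = ∑ R ∈ S.powerset, ∑ T ∈ Finset.powersetCard k (Finset.univ : Finset (Fin n)),
          if R ⊆ T then (Z - 1) ^ R.card else 0 := by
        rw [Finset.sum_comm]
        exact Finset.sum_congr rfl fun T _ => hexp T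
    _ ≤ ∑ R ∈ S.powerset, (n.choose k : ℝ) *
          (((k : ℝ) / n * (Z - 1)) ^ R.card * 1 ^ (S.card - R.card)) := by
        refine Finset.sum_le_sum fun R hR => ?_
        rw [← Finset.sum_filter, Finset.sum_const, nsmul_eq_mul, one_pow, mul_one, mul_pow,
          ← mul_assoc]
        exact mul_le_mul_of_nonneg_right (hcount R hR) (pow_nonneg (by linarith) _)
    _ = n.choose k * ((k : ℝ) / n * (Z - 1) + 1) ^ k := by
        rw [← Finset.mul_sum, Finset.sum_pow_mul_eq_add_pow, hS]
    _ ≤ n.choose k * Real.exp (Z * (k ^ 2 / n)) := by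
        refine mul_le_mul_of_nonneg_left ?_ (Nat.cast_nonneg _)
        have h0 : (0 : ℝ) ≤ (k : ℝ) / n := by positivity
        calc ((k : ℝ) / n * (Z - 1) + 1) ^ k ≤ (Real.exp ((k : ℝ) / n * (Z - 1))) ^ k :=
              pow_le_pow_left₀ (by nlinarith) (Real.add_one_le_exp _) k
          _ = Real.exp (k * ((k : ℝ) / n * (Z - 1))) := by rw [← Real.exp_nat_mul]
          _ ≤ _ := by
              refine Real.exp_le_exp.2 ?_
              have : (0 : ℝ) ≤ k * (k / n) := by positivity
              calc (k : ℝ) * (k / n * (Z - 1)) = (k * (k / n)) * (Z - 1) := by ring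
                _ ≤ (k * (k / n)) * Z := by nlinarith
                _ = _ := by ring

/-- Splitting the powers of `X` at the real exponent `s`: those beyond it are charged to `W`. -/
lemma pow_le_rpow_add_rpow_mul_pow {X W s : ℝ} (hX : 1 ≤ X) (hXW : X ≤ W) (l : ℕ) :
    X ^ l ≤ X ^ s + (X / W) ^ s * W ^ l := by
  have hX0 : 0 < X := by linarith
  have hW0 : 0 < W := by linarith
  rcases le_total (l : ℝ) s with h | h
  · have h1 : X ^ l ≤ X ^ s := by
      rw [← Real.rpow_natCast]
      exact Real.rpow_le_rpow_of_exponent_le hX h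
    have h2 : 0 ≤ (X / W) ^ s * W ^ l := by positivity
    linarith
  · have h1 : X ^ ((l : ℝ) - s) ≤ W ^ ((l : ℝ) - s) :=
      Real.rpow_le_rpow hX0.le hXW (by linarith)
    have h2 : X ^ l = X ^ s * X ^ ((l : ℝ) - s) := by
      rw [← Real.rpow_add hX0, add_sub_cancel, Real.rpow_natCast]
    have h3 : (X / W) ^ s * W ^ l = X ^ s * W ^ ((l : ℝ) - s) := by
      rw [Real.div_rpow hX0.le hW0.le, Real.rpow_sub hW0, Real.rpow_natCast]
      ring
    rw [h3, h2]
    have h4 : 0 ≤ X ^ s := by positivity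
    nlinarith [mul_le_mul_of_nonneg_left h1 h4]

/-- Over a set `A` of planted sets, the average of `X ^ |S ∩ T|` is of order `X ^ s` unless `A` is
as rare as an intersection of size `s`, that is, unless its relative size is at most about
`W ^ (-s)`. -/
lemma sum_sum_pow_card_inter_le {n k : ℕ} (hkn : k ≤ n) {X W s : ℝ} (hX : 1 ≤ X) (hXW : X ≤ W)
    (hW : W * (k ^ 2 / n) ≤ 1) {A : Finset (Finset (Fin n))}
    (hA : A ⊆ Finset.powersetCard k Finset.univ) :
    ∑ S ∈ A, ∑ T ∈ A, X ^ (S ∩ T).card ≤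
      A.card * (A.card * X ^ s + 3 * (X / W) ^ s * n.choose k) := by
  have hX0 : 0 < X := by linarith
  have hW0 : 0 < W := by linarith
  have hrow : ∀ S ∈ A, ∑ T ∈ A, X ^ (S ∩ T).card ≤
      A.card * X ^ s + 3 * (X / W) ^ s * n.choose k := by
    intro S hS
    have hSk : S.card = k := (Finset.mem_powersetCard.1 (hA hS)).2
    have h1 : ∑ T ∈ A, W ^ (S ∩ T).card ≤ n.choose k * 3 := by
      calc ∑ T ∈ A, W ^ (S ∩ T).card
          ≤ ∑ T ∈ Finset.powersetCard k Finset.univ, W ^ (S ∩ T).card :=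
            Finset.sum_le_sum_of_subset_of_nonneg hA fun _ _ _ => by positivity
        _ ≤ n.choose k * Real.exp (W * (k ^ 2 / n)) :=
            sum_pow_card_inter_le hkn S hSk (hX.trans hXW)
        _ ≤ n.choose k * 3 := by
            refine mul_le_mul_of_nonneg_left ?_ (Nat.cast_nonneg _)
            exact (Real.exp_le_exp.2 hW).trans Real.exp_one_lt_three.le
    calc ∑ T ∈ A, X ^ (S ∩ T).card ≤ ∑ T ∈ A, (X ^ s + (X / W) ^ s * W ^ (S ∩ T).card) :=
          Finset.sum_le_sum fun T _ => pow_le_rpow_add_rpow_mul_pow hX hXW _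
      _ = A.card * X ^ s + (X / W) ^ s * ∑ T ∈ A, W ^ (S ∩ T).card := by
          rw [Finset.sum_add_distrib, Finset.sum_const, nsmul_eq_mul, Finset.mul_sum]
      _ ≤ A.card * X ^ s + (X / W) ^ s * (n.choose k * 3) := by gcongr
      _ = _ := by ring
  calc _ ≤ ∑ S ∈ A, (A.card * X ^ s + 3 * (X / W) ^ s * n.choose k) := Finset.sum_le_sum hrow
    _ = _ := by rw [Finset.sum_const, nsmul_eq_mul]

end Combinatorics

/-! ### Densities of the hidden hubs distributions -/

section PlantedDensity

variable {n : ℕ}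

lemma lintegral_pi_prod_eq_prod (μ : Fin n → Measure ℝ) [∀ i, IsProbabilityMeasure (μ i)]
    {f : Fin n → ℝ → ℝ≥0∞} (hf : ∀ i, Measurable (f i)) :
    ∫⁻ x, ∏ i, f i (x i) ∂Measure.pi μ = ∏ i, ∫⁻ y, f i y ∂μ i := by
  have h := lintegral_prod_eq_prod_lintegral_of_indepFun (μ := Measure.pi μ) Finset.univ
    (fun i (x : Fin n → ℝ) => f i (x i)) (iIndepFun_pi fun i => (hf i).aemeasurable)
    fun i => (hf i).comp (measurable_pi_apply i)
  refine h.trans ?_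
  exact Finset.prod_congr rfl fun i _ => (measurePreserving_eval μ i).lintegral_comp (hf i)

lemma pi_withDensity (μ : Fin n → Measure ℝ) [∀ i, IsProbabilityMeasure (μ i)]
    {f : Fin n → ℝ → ℝ≥0∞} (hf : ∀ i, Measurable (f i))
    [∀ i, SigmaFinite ((μ i).withDensity (f i))] :
    Measure.pi (fun i => (μ i).withDensity (f i)) =
      (Measure.pi μ).withDensity fun x => ∏ i, f i (x i) := by
  classical
  refine Measure.pi_eq fun s hs => ?_
  have hm : MeasurableSet (Set.univ.pi s) := MeasurableSet.univ_pi hs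
  rw [withDensity_apply _ hm, ← lintegral_indicator hm]
  have e : ∀ x : Fin n → ℝ, (Set.univ.pi s).indicator (fun x => ∏ i, f i (x i)) x =
      ∏ i, (s i).indicator (f i) (x i) := by
    intro x
    by_cases hx : x ∈ Set.univ.pi s
    · rw [Set.indicator_of_mem hx]
      exact Finset.prod_congr rfl fun i _ => (Set.indicator_of_mem (hx i trivial) _).symm
    · rw [Set.indicator_of_notMem hx]
      simp only [Set.mem_pi, Set.mem_univ, true_imp_iff, not_forall] at hx
      obtain ⟨i, hi⟩ := hx
      exact (Finset.prod_eq_zero (Finset.mem_univ i) (Set.indicator_of_notMem hi _)).symm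
  simp_rw [e]
  rw [lintegral_pi_prod_eq_prod μ fun i => (hf i).indicator (hs i)]
  refine Finset.prod_congr rfl fun i _ => ?_
  rw [lintegral_indicator (hs i), withDensity_apply _ (hs i)]

/-- The product of the values of `ψ` at the coordinates in `S`. -/
def prodOver (S : Finset (Fin n)) (ψ : ℝ → ℝ) (x : Fin n → ℝ) : ℝ :=
  ∏ i, if i ∈ S then ψ (x i) else 1

section ProdOver

variable {G : Measure ℝ} [IsProbabilityMeasure G] {ψ : ℝ → ℝ}

lemma integral_prodOver (S : Finset (Fin n)) :
    ∫ x, prodOver S ψ x ∂Measure.pi (fun _ => G) = (∫ y, ψ y ∂G) ^ S.card := by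
  have h := integral_fintype_prod_eq_prod (μ := fun _ : Fin n => G)
    (fun i y => if i ∈ S then ψ y else 1)
  unfold prodOver
  rw [h]
  have e : ∀ i, (∫ y, (if i ∈ S then ψ y else 1) ∂G) = if i ∈ S then ∫ y, ψ y ∂G else 1 := by
    intro i
    split_ifs <;> simp
  simp_rw [e]
  simp

lemma memLp_prodOver (hψ : MemLp ψ 2 G) (S : Finset (Fin n)) :
    MemLp (prodOver S ψ) 2 (Measure.pi fun _ => G) := by
  have hi : ∀ i, MemLp (fun y => if i ∈ S then ψ y else 1) 2 G := by
    intro i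
    by_cases h : i ∈ S
    · simpa [h] using hψ
    · simpa [h] using memLp_const (1 : ℝ)
  have h1 : Integrable (prodOver S ψ) (Measure.pi fun _ => G) :=
    Integrable.fintype_prod (μ := fun _ : Fin n => G) fun i => (hi i).integrable (by norm_num)
  rw [memLp_two_iff_integrable_sq h1.aestronglyMeasurable]
  have h2 : Integrable (fun x : Fin n → ℝ => ∏ i, (fun y => (if i ∈ S then ψ y else 1) ^ 2) (x i))
      (Measure.pi fun _ => G) :=
    Integrable.fintype_prod (μ := fun _ : Fin n => G)
      (f := fun i y => (if i ∈ S then ψ y else 1) ^ 2) fun i => (hi i).integrable_sq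
  refine h2.congr (ae_of_all _ fun x => ?_)
  simp only [prodOver, Finset.prod_pow]

lemma integral_prodOver_mul_prodOver_le {Y : ℝ} (hψ0 : 0 ≤ ∫ y, ψ y ∂G)
    (hψ1 : ∫ y, ψ y ∂G ≤ 1) (hY : ∫ y, ψ y ^ 2 ∂G ≤ Y) (S T : Finset (Fin n)) :
    ∫ x, prodOver S ψ x * prodOver T ψ x ∂Measure.pi (fun _ => G) ≤ Y ^ (S ∩ T).card := by
  have h := integral_fintype_prod_eq_prod (μ := fun _ : Fin n => G)
    (fun i y => (if i ∈ S then ψ y else 1) * (if i ∈ T then ψ y else 1))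
  unfold prodOver
  simp_rw [← Finset.prod_mul_distrib]
  rw [h]
  have hnn : ∀ i : Fin n,
      0 ≤ ∫ y, (if i ∈ S then ψ y else 1) * (if i ∈ T then ψ y else 1) ∂G := by
    intro i
    split_ifs
    · exact integral_nonneg fun y => mul_self_nonneg _
    · simpa using hψ0
    · simpa using hψ0
    · simp
  calc _ ≤ ∏ i : Fin n, if i ∈ S ∩ T then Y else 1 := by
        refine Finset.prod_le_prod (fun i _ => hnn i) fun i _ => ?_
        by_cases h1 : i ∈ S <;> by_cases h2 : i ∈ T <;> simp [h1, h2, hψ1, ← sq, hY]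
    _ = _ := by
        rw [Finset.prod_ite_mem]
        simp

lemma densityCorrelation_eq {X : Type} [MeasurableSpace X] {U : Measure X} [IsProbabilityMeasure U]
    {g h : X → ℝ} (hg : MemLp g 2 U) (hh : MemLp h 2 U) :
    densityCorrelation U g h = ∫ x, g x * h x ∂U - ∫ x, g x ∂U - ∫ x, h x ∂U + 1 := by
  have i1 : Integrable (fun x => g x * h x) U := hg.integrable_mul hh
  have i2 : Integrable g U := hg.integrable (by norm_num)
  have i3 : Integrable h U := hh.integrable (by norm_num)
  have e : ∀ x, (g x - 1) * (h x - 1) = g x * h x - g x - h x + 1 := fun x => by ring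
  unfold densityCorrelation
  have i4 : Integrable (fun x => g x * h x - g x) U := i1.sub i2
  have i5 : Integrable (fun x => g x * h x - g x - h x) U := i4.sub i3
  simp_rw [e]
  rw [integral_add i5 (integrable_const _), integral_sub i4 i3, integral_sub i1 i2]
  simp

end ProdOver

/-- The density, relative to the product of the base distribution, of the hidden hubs distribution
with planted set `S` and mixing weight `κ`, where `φ` is the density of the second component. It is
used for `φ` of total mass below one, the truncated density of the second component. -/
noncomputable def plantedDensity (κ : ℝ) (φ : ℝ → ℝ) (S : Finset (Fin n)) :
    PlantingModel → (Fin n → ℝ) → ℝ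
  | .simultaneous => fun x => (1 - κ) + κ * prodOver S φ x
  | .independent => prodOver S fun y => (1 - κ) + κ * φ y

variable {G : Measure ℝ} [IsProbabilityMeasure G] {φ : ℝ → ℝ} {κ : ℝ}

lemma memLp_mixture {X : Type} [MeasurableSpace X] {U : Measure X} [IsFiniteMeasure U] {ψ : X → ℝ}
    (hψ : MemLp ψ 2 U) (κ : ℝ) : MemLp (fun x => (1 - κ) + κ * ψ x) 2 U := by
  have h1 : MemLp (fun _ : X => 1 - κ) 2 U := memLp_const _
  have h2 : MemLp (fun x => κ * ψ x) 2 U := hψ.const_mul κ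
  exact h1.add h2

lemma memLp_plantedDensity (hφ : MemLp φ 2 G) (M : PlantingModel) (S : Finset (Fin n)) :
    MemLp (plantedDensity κ φ S M) 2 (Measure.pi fun _ => G) := by
  cases M with
  | simultaneous => exact memLp_mixture (memLp_prodOver hφ S) κ
  | independent => exact memLp_prodOver (memLp_mixture hφ κ) S

lemma integral_mixture (hφ : MemLp φ 2 G) :
    ∫ y, ((1 - κ) + κ * φ y) ∂G = 1 - κ * (1 - ∫ y, φ y ∂G) := by
  rw [integral_add (integrable_const _) ((hφ.integrable (by norm_num)).const_mul κ),
    integral_const_mul]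
  simp
  ring

lemma one_sub_mul_one_sub_le_pow {k : ℕ} {γ : ℝ} (hγ0 : 0 ≤ γ) : 1 - k * (1 - γ) ≤ γ ^ k := by
  have := one_add_mul_le_pow (a := γ - 1) (by linarith) k
  rw [add_sub_cancel] at this
  linarith

lemma one_sub_integral_plantedDensity_le (hφ : MemLp φ 2 G) (hκ0 : 0 ≤ κ) (hκ1 : κ ≤ 1)
    (hφ0 : 0 ≤ ∫ y, φ y ∂G) (M : PlantingModel) (S : Finset (Fin n)) :
    1 - ∫ x, plantedDensity κ φ S M x ∂Measure.pi (fun _ => G) ≤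
      S.card * κ * (1 - ∫ y, φ y ∂G) := by
  cases M with
  | simultaneous =>
    have h1 := one_sub_mul_one_sub_le_pow (k := S.card) hφ0
    have hi : Integrable (prodOver S φ) (Measure.pi fun _ => G) :=
      (memLp_prodOver hφ S).integrable (by norm_num)
    simp only [plantedDensity]
    rw [integral_add (integrable_const _) (hi.const_mul κ), integral_const_mul, integral_prodOver]
    simp only [integral_const, probReal_univ, smul_eq_mul, one_mul]
    nlinarith
  | independent =>
    simp only [plantedDensity]
    rw [integral_prodOver, integral_mixture hφ]
    have h1 := one_sub_mul_one_sub_le_pow (k := S.card) (γ := 1 - κ * (1 - ∫ y, φ y ∂G))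
      (by nlinarith)
    linarith

/-- For `s = κ²` this bounds the correlations of the independent model by those of the
simultaneous one. -/
lemma one_add_mul_pow_sub_one_le {s x : ℝ} (hs0 : 0 ≤ s) (hs1 : s ≤ 1) (hx : 0 ≤ x) (l : ℕ) :
    (1 + s * x) ^ l - 1 ≤ s * ((1 + x) ^ l - 1) := by
  induction l with
  | zero => simp
  | succ l ih =>
    have h1 : 1 ≤ (1 + x) ^ l := one_le_pow₀ (by linarith)
    rw [pow_succ, pow_succ]
    have h2 : (1 + s * x) ^ l * (1 + s * x) ≤ (1 + s * ((1 + x) ^ l - 1)) * (1 + s * x) :=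
      mul_le_mul_of_nonneg_right (by linarith) (by positivity)
    have h3 : s * s * (x * ((1 + x) ^ l - 1)) ≤ s * 1 * (x * ((1 + x) ^ l - 1)) :=
      mul_le_mul_of_nonneg_right (mul_le_mul_of_nonneg_left hs1 hs0)
        (mul_nonneg hx (by linarith))
    nlinarith

/-- In both models the correlation of two hidden hubs densities is of order `κ²` and exponential in
the size of the intersection of the planted sets. -/
lemma densityCorrelation_plantedDensity_le (hφ : MemLp φ 2 G) (hκ0 : 0 ≤ κ) (hκ1 : κ ≤ 1)
    (hφ0 : 0 ≤ ∫ y, φ y ∂G) (hφ1 : ∫ y, φ y ∂G ≤ 1) {X : ℝ} (hX : 2 ≤ X)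
    (hφX : ∫ y, φ y ^ 2 ∂G ≤ X - 1) {k : ℕ} (hk : 2 * k * (1 - ∫ y, φ y ∂G) ≤ κ)
    (M : PlantingModel) {S T : Finset (Fin n)} (hS : S.card = k) (hT : T.card = k) :
    densityCorrelation (Measure.pi fun _ => G) (plantedDensity κ φ S M) (plantedDensity κ φ T M) ≤
      2 * κ ^ 2 * X ^ (S ∩ T).card := by
  have hXl : 1 ≤ X ^ (S ∩ T).card := one_le_pow₀ (by linarith)
  cases M with
  | simultaneous =>
    have e : densityCorrelation (Measure.pi fun _ => G) (plantedDensity κ φ S .simultaneous)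
        (plantedDensity κ φ T .simultaneous) =
        κ ^ 2 * densityCorrelation (Measure.pi fun _ => G) (prodOver S φ) (prodOver T φ) := by
      unfold densityCorrelation
      rw [← integral_const_mul]
      refine integral_congr_ae (ae_of_all _ fun x => ?_)
      simp only [plantedDensity]
      ring
    rw [e, densityCorrelation_eq (memLp_prodOver hφ S) (memLp_prodOver hφ T), integral_prodOver,
      integral_prodOver]
    have h1 := integral_prodOver_mul_prodOver_le hφ0 hφ1 (hφX.trans (sub_le_self X zero_le_one)) S T
    have h2 : 0 ≤ (∫ y, φ y ∂G) ^ S.card := by positivity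
    have h3 : 0 ≤ (∫ y, φ y ∂G) ^ T.card := by positivity
    nlinarith [sq_nonneg κ]
  | independent =>
    set ψ : ℝ → ℝ := fun y => (1 - κ) + κ * φ y with hψ
    have hψm : MemLp ψ 2 G := memLp_mixture hφ κ
    have hφi : Integrable φ G := hφ.integrable (by norm_num)
    have hmean : ∫ y, ψ y ∂G = 1 - κ * (1 - ∫ y, φ y ∂G) := integral_mixture hφ
    have hsq : ∫ y, ψ y ^ 2 ∂G ≤ 1 + κ ^ 2 * (X - 1) := by
      have e : ∀ y, ψ y ^ 2 = (1 - κ) ^ 2 + (2 * κ * (1 - κ) * φ y + κ ^ 2 * φ y ^ 2) := by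
        intro y
        simp only [hψ]
        ring
      have i1 : Integrable (fun y => 2 * κ * (1 - κ) * φ y) G := hφi.const_mul _
      have i2 : Integrable (fun y => κ ^ 2 * φ y ^ 2) G := hφ.integrable_sq.const_mul _
      have i3 : Integrable (fun y => 2 * κ * (1 - κ) * φ y + κ ^ 2 * φ y ^ 2) G := i1.add i2
      simp_rw [e]
      rw [integral_add (integrable_const _) i3, integral_add i1 i2, integral_const_mul,
        integral_const_mul]
      simp only [integral_const, probReal_univ, smul_eq_mul, one_mul]
      have h1 : 2 * κ * (1 - κ) * ∫ y, φ y ∂G ≤ 2 * κ * (1 - κ) * 1 :=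
        mul_le_mul_of_nonneg_left hφ1 (by nlinarith)
      have h2 := mul_le_mul_of_nonneg_left hφX (sq_nonneg κ)
      nlinarith [sq_nonneg κ]
    simp only [plantedDensity]
    rw [densityCorrelation_eq (memLp_prodOver hψm S) (memLp_prodOver hψm T), integral_prodOver,
      integral_prodOver, hmean, hS, hT]
    have h1 := integral_prodOver_mul_prodOver_le (ψ := ψ) (by rw [hmean]; nlinarith)
      (by rw [hmean]; nlinarith) hsq S T
    have h2 := one_sub_mul_one_sub_le_pow (k := k) (γ := 1 - κ * (1 - ∫ y, φ y ∂G)) (by nlinarith)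
    have h3 := one_add_mul_pow_sub_one_le (sq_nonneg κ) (by nlinarith) (by linarith : 0 ≤ X - 1)
      (S ∩ T).card
    rw [add_sub_cancel] at h3
    have h4 : 2 * (k * (κ * (1 - ∫ y, φ y ∂G))) ≤ κ ^ 2 := by nlinarith
    nlinarith [sq_nonneg κ]

lemma plantedDensity_nonneg (hφ : ∀ y, 0 ≤ φ y) (hκ0 : 0 ≤ κ) (hκ1 : κ ≤ 1) (M : PlantingModel)
    (S : Finset (Fin n)) (x : Fin n → ℝ) : 0 ≤ plantedDensity κ φ S M x := by
  have h : ∀ ψ : ℝ → ℝ, (∀ y, 0 ≤ ψ y) → 0 ≤ prodOver S ψ x := by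
    intro ψ hψ
    refine Finset.prod_nonneg fun i _ => ?_
    split_ifs
    · exact hψ _
    · exact zero_le_one
  cases M with
  | simultaneous => exact add_nonneg (by linarith) (mul_nonneg hκ0 (h φ hφ))
  | independent => exact h _ fun y => add_nonneg (by linarith) (mul_nonneg hκ0 (hφ y))

end PlantedDensity

section Planted

variable {n k : ℕ} {m : ℝ} {σ₀ σ₁ : ℝ≥0}

instance isProbabilityMeasure_unplanted : IsProbabilityMeasure (unplanted n σ₀) := by
  unfold unplanted
  infer_instance

lemma natCast_div_le_one (hkn : k ≤ n) : (k : ℝ≥0∞) / n ≤ 1 :=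
  ENNReal.div_le_of_le_mul (by rw [one_mul]; exact_mod_cast hkn)

lemma isProbabilityMeasure_mixture {X : Type} [MeasurableSpace X] {w : ℝ≥0∞} (hw : w ≤ 1)
    (μ ν : Measure X) [IsProbabilityMeasure μ] [IsProbabilityMeasure ν] :
    IsProbabilityMeasure ((1 - w) • μ + w • ν) :=
  ⟨by simp [tsub_add_cancel_of_le hw]⟩

lemma isProbabilityMeasure_planted (hkn : k ≤ n) (S : Finset (Fin n)) (M : PlantingModel) :
    IsProbabilityMeasure (planted n k m σ₀ σ₁ S M) := by
  have hw := natCast_div_le_one hkn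
  cases M with
  | simultaneous =>
    have : ∀ i : Fin n, IsProbabilityMeasure
        (if i ∈ S then gaussianReal m (σ₁ ^ 2) else gaussianReal 0 (σ₀ ^ 2)) := by
      intro i
      split_ifs <;> infer_instance
    exact isProbabilityMeasure_mixture hw _ _
  | independent =>
    have : ∀ i : Fin n, IsProbabilityMeasure
        (if i ∈ S then (1 - (k : ℝ≥0∞) / n) • gaussianReal 0 (σ₀ ^ 2) +
            ((k : ℝ≥0∞) / n) • gaussianReal m (σ₁ ^ 2)
          else gaussianReal 0 (σ₀ ^ 2)) := by
      intro i
      split_ifs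
      · exact isProbabilityMeasure_mixture hw _ _
      · infer_instance
    unfold planted
    infer_instance

lemma pi_ite_withDensity {G G' : Measure ℝ} [IsProbabilityMeasure G] [IsProbabilityMeasure G']
    {Ψ : ℝ → ℝ≥0∞} (hΨ : Measurable Ψ) (h : G' = G.withDensity Ψ) (S : Finset (Fin n)) :
    (Measure.pi fun i => if i ∈ S then G' else G) =
      (Measure.pi fun _ => G).withDensity fun x => ∏ i, if i ∈ S then Ψ (x i) else 1 := by
  have e : ∀ i, G.withDensity (fun y => if i ∈ S then Ψ y else 1) = if i ∈ S then G' else G := by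
    intro i
    split_ifs
    · exact h.symm
    · exact withDensity_one
  have hsf : ∀ i, SigmaFinite (G.withDensity (fun y => if i ∈ S then Ψ y else 1)) := by
    intro i
    rw [e i]
    split_ifs <;> infer_instance
  have hp := pi_withDensity (fun _ : Fin n => G) (f := fun i y => if i ∈ S then Ψ y else 1)
    (fun i => by split_ifs <;> fun_prop)
  simp_rw [e] at hp
  exact hp

lemma withDensity_mixture {X : Type} [MeasurableSpace X] (μ : Measure X) {Ψ : X → ℝ≥0∞}
    (hΨ : Measurable Ψ) (w w' : ℝ≥0∞) :
    μ.withDensity (fun x => w + w' * Ψ x) = w • μ + w' • μ.withDensity Ψ := by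
  have : (fun x => w + w' * Ψ x) = (fun _ => w) + w' • Ψ := by
    ext x
    simp
  rw [this, withDensity_add_left measurable_const, withDensity_const, withDensity_smul _ hΨ]

lemma ofReal_prodOver_le {ψ : ℝ → ℝ} {Ψ : ℝ → ℝ≥0∞} (hψ : ∀ y, 0 ≤ ψ y)
    (h : ∀ y, ENNReal.ofReal (ψ y) ≤ Ψ y) (S : Finset (Fin n)) (x : Fin n → ℝ) :
    ENNReal.ofReal (prodOver S ψ x) ≤ ∏ i, if i ∈ S then Ψ (x i) else 1 := by
  unfold prodOver
  rw [ENNReal.ofReal_prod_of_nonneg fun i _ => by split_ifs; exacts [hψ _, zero_le_one]]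
  refine Finset.prod_le_prod' fun i _ => ?_
  split_ifs
  · exact h _
  · simp

/-- The planted distribution dominates the measure whose density is built from a truncation `φ` of
the density `Φ` of the second component. -/
lemma setIntegral_plantedDensity_le {φ : ℝ → ℝ} {Φ : ℝ → ℝ≥0∞} (hn : 0 < n) (hkn : k ≤ n)
    (hφ : ∀ y, 0 ≤ φ y) (hφ2 : MemLp φ 2 (gaussianReal 0 (σ₀ ^ 2)))
    (hφΦ : ∀ y, ENNReal.ofReal (φ y) ≤ Φ y) (hΦ : Measurable Φ)
    (h : gaussianReal m (σ₁ ^ 2) = (gaussianReal 0 (σ₀ ^ 2)).withDensity Φ)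
    (M : PlantingModel) (S : Finset (Fin n)) {E : Set (Fin n → ℝ)} (hE : MeasurableSet E) :
    ∫ x in E, plantedDensity ((k : ℝ) / n) φ S M x ∂unplanted n σ₀ ≤
      (planted n k m σ₀ σ₁ S M).real E := by
  have hn' : (0 : ℝ) < n := by exact_mod_cast hn
  have hκ0 : 0 ≤ (k : ℝ) / n := by positivity
  have hκ1 : (k : ℝ) / n ≤ 1 := by
    rw [div_le_one hn']
    exact_mod_cast hkn
  have hκ : ENNReal.ofReal ((k : ℝ) / n) = (k : ℝ≥0∞) / n := by
    rw [ENNReal.ofReal_div_of_pos hn', ENNReal.ofReal_natCast, ENNReal.ofReal_natCast]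
  have hκ' : ENNReal.ofReal (1 - (k : ℝ) / n) = 1 - (k : ℝ≥0∞) / n := by
    rw [ENNReal.ofReal_sub _ hκ0, hκ, ENNReal.ofReal_one]
  have hprob := isProbabilityMeasure_planted (m := m) (σ₀ := σ₀) (σ₁ := σ₁) hkn S M
  have hprodm : ∀ Ψ : ℝ → ℝ≥0∞, Measurable Ψ →
      Measurable fun x : Fin n → ℝ => ∏ i, if i ∈ S then Ψ (x i) else 1 := by
    intro Ψ hΨ
    refine Finset.measurable_prod _ fun i _ => ?_
    split_ifs <;> fun_prop
  -- the full density of the planted distribution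
  obtain ⟨H, hH, hle⟩ : ∃ H : (Fin n → ℝ) → ℝ≥0∞,
      planted n k m σ₀ σ₁ S M = (unplanted n σ₀).withDensity H ∧
        ∀ x, ENNReal.ofReal (plantedDensity ((k : ℝ) / n) φ S M x) ≤ H x := by
    cases M with
    | simultaneous =>
      refine ⟨fun x => (1 - (k : ℝ≥0∞) / n) +
        (k : ℝ≥0∞) / n * ∏ i, if i ∈ S then Φ (x i) else 1, ?_, fun x => ?_⟩
      · rw [withDensity_mixture _ (hprodm Φ hΦ), planted, pi_ite_withDensity hΦ h]
        rfl
      · simp only [plantedDensity]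
        rw [← hκ', ← hκ]
        refine ENNReal.ofReal_add_le.trans (add_le_add le_rfl ?_)
        rw [ENNReal.ofReal_mul hκ0]
        exact mul_le_mul_right (ofReal_prodOver_le hφ hφΦ S x) _
    | independent =>
      have hΨ : Measurable fun y => (1 - (k : ℝ≥0∞) / n) + (k : ℝ≥0∞) / n * Φ y := by fun_prop
      refine ⟨fun x => ∏ i, if i ∈ S then
        (1 - (k : ℝ≥0∞) / n) + (k : ℝ≥0∞) / n * Φ (x i) else 1, ?_, fun x => ?_⟩
      · have := isProbabilityMeasure_mixture (natCast_div_le_one hkn)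
          (gaussianReal 0 (σ₀ ^ 2)) (gaussianReal m (σ₁ ^ 2))
        rw [planted]
        refine pi_ite_withDensity hΨ ?_ S
        rw [withDensity_mixture _ hΦ, h]
      · refine ofReal_prodOver_le (Ψ := fun y => (1 - (k : ℝ≥0∞) / n) + (k : ℝ≥0∞) / n * Φ y)
          (fun y => add_nonneg (by linarith) (mul_nonneg hκ0 (hφ y))) (fun y => ?_) S x
        rw [← hκ', ← hκ]
        refine ENNReal.ofReal_add_le.trans (add_le_add le_rfl ?_)
        rw [ENNReal.ofReal_mul hκ0]
        exact mul_le_mul_right (hφΦ y) _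
  have hmem : MemLp (plantedDensity ((k : ℝ) / n) φ S M) 2 (unplanted n σ₀) :=
    memLp_plantedDensity hφ2 M S
  rw [integral_eq_lintegral_of_nonneg_ae
    (ae_of_all _ fun x => plantedDensity_nonneg hφ hκ0 hκ1 M S x)
    hmem.aestronglyMeasurable.restrict]
  refine ENNReal.toReal_mono (measure_ne_top _ _) ?_
  rw [hH, withDensity_apply _ hE]
  exact lintegral_mono hle

/-- The fraction of planted sets that one query distinguishes, in terms of free parameters: `X`
bounds the second moment of the truncated density `φ`, and `s` is the size of an intersection of
planted sets that is considered rare. -/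
lemma card_distinguished_planted_le {φ : ℝ → ℝ} {Φ : ℝ → ℝ≥0∞} (hn : 0 < n) (hkn : k ≤ n)
    (hφ : ∀ y, 0 ≤ φ y) (hφ2 : MemLp φ 2 (gaussianReal 0 (σ₀ ^ 2)))
    (hφΦ : ∀ y, ENNReal.ofReal (φ y) ≤ Φ y) (hΦ : Measurable Φ)
    (h : gaussianReal m (σ₁ ^ 2) = (gaussianReal 0 (σ₀ ^ 2)).withDensity Φ)
    (hφ1 : ∫ y, φ y ∂gaussianReal 0 (σ₀ ^ 2) ≤ 1)
    {X W s : ℝ} (hX : 2 ≤ X) (hφX : ∫ y, φ y ^ 2 ∂gaussianReal 0 (σ₀ ^ 2) ≤ X - 1)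
    (hXW : X ≤ W) (hW : W * (k ^ 2 / n) ≤ 1) {t : ℕ} (ht : 1 ≤ t)
    (hmass : 2 * n * (1 - ∫ y, φ y ∂gaussianReal 0 (σ₀ ^ 2)) ≤ 1)
    (hmasst : (1 - ∫ y, φ y ∂gaussianReal 0 (σ₀ ^ 2)) ≤ 1 / (2 * t))
    (ha : 2 * ((k : ℝ) / n) ^ 2 * X ^ s ≤ 1 / (64 * t))
    (M : PlantingModel) {f : (Fin n → ℝ) → Bool} (hf : Measurable f) :
    ((distinguished (unplanted n σ₀) (fun S => planted n k m σ₀ σ₁ S M) t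
      (Finset.powersetCard k Finset.univ) f).card : ℝ) ≤
      128 * t * (6 * ((k : ℝ) / n) ^ 2 * (X / W) ^ s * n.choose k) := by
  have hn' : (0 : ℝ) < n := by exact_mod_cast hn
  have hκ0 : 0 ≤ (k : ℝ) / n := by positivity
  have hκ1 : (k : ℝ) / n ≤ 1 := by
    rw [div_le_one hn']
    exact_mod_cast hkn
  have hX0 : 0 < X := by linarith
  have hW0 : 0 < W := by linarith
  have hφ0 : 0 ≤ ∫ y, φ y ∂gaussianReal 0 (σ₀ ^ 2) := integral_nonneg hφ
  have hk : 2 * k * (1 - ∫ y, φ y ∂gaussianReal 0 (σ₀ ^ 2)) ≤ (k : ℝ) / n := by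
    rw [le_div_iff₀ hn']
    nlinarith [(Nat.cast_nonneg k : (0 : ℝ) ≤ k)]
  refine card_distinguished_le (h := fun S => plantedDensity ((k : ℝ) / n) φ S M)
    (fun S => isProbabilityMeasure_planted hkn S M) ht
    (fun S => memLp_plantedDensity hφ2 M S)
    (fun S _ E hE => setIntegral_plantedDensity_le hn hkn hφ hφ2 hφΦ hΦ h M S hE)
    (fun S hS => ?_) ha (fun A hA => ?_) (by positivity) hf
  · have hSk : S.card = k := (Finset.mem_powersetCard.1 hS).2
    refine (one_sub_integral_plantedDensity_le hφ2 hκ0 hκ1 hφ0 M S).trans ?_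
    have h1 : (k : ℝ) * (k / n) ≤ 1 := by
      have : 1 * ((k : ℝ) ^ 2 / n) ≤ W * (k ^ 2 / n) :=
        mul_le_mul_of_nonneg_right (by linarith) (by positivity)
      rw [← mul_div_assoc, ← sq]
      linarith
    rw [hSk]
    nlinarith
  · calc _ ≤ ∑ S ∈ A, ∑ T ∈ A, 2 * ((k : ℝ) / n) ^ 2 * X ^ (S ∩ T).card := by
          refine Finset.sum_le_sum fun S hS => Finset.sum_le_sum fun T hT => ?_
          exact densityCorrelation_plantedDensity_le hφ2 hκ0 hκ1 hφ0 hφ1 hX hφX hk M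
            (Finset.mem_powersetCard.1 (hA hS)).2 (Finset.mem_powersetCard.1 (hA hT)).2
      _ = 2 * ((k : ℝ) / n) ^ 2 * ∑ S ∈ A, ∑ T ∈ A, X ^ (S ∩ T).card := by
          simp_rw [Finset.mul_sum]
      _ ≤ 2 * ((k : ℝ) / n) ^ 2 *
            (A.card * (A.card * X ^ s + 3 * (X / W) ^ s * n.choose k)) :=
          mul_le_mul_of_nonneg_left (sum_sum_pow_card_inter_le hkn (by linarith) hXW hW hA)
            (by positivity)
      _ = _ := by ring

end Planted

/-! ### From a second moment bound to lower bounds for detection -/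

/-- `N(m, σ₁²)` has a density with respect to `N(0, σ₀²)`, and a minorant `φ` of that density loses
mass at most `loss` and has second moment at most `B` under `N(0, σ₀²)`. -/
def HasTruncatedDensity (m : ℝ) (σ₀ σ₁ : ℝ≥0) (loss B : ℝ) : Prop :=
  ∃ (φ : ℝ → ℝ) (Φ : ℝ → ℝ≥0∞), (∀ y, 0 ≤ φ y) ∧ MemLp φ 2 (gaussianReal 0 (σ₀ ^ 2)) ∧
    (∀ y, ENNReal.ofReal (φ y) ≤ Φ y) ∧ Measurable Φ ∧
    gaussianReal m (σ₁ ^ 2) = (gaussianReal 0 (σ₀ ^ 2)).withDensity Φ ∧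
    ∫ y, φ y ∂gaussianReal 0 (σ₀ ^ 2) ≤ 1 ∧ 1 - ∫ y, φ y ∂gaussianReal 0 (σ₀ ^ 2) ≤ loss ∧
    ∫ y, φ y ^ 2 ∂gaussianReal 0 (σ₀ ^ 2) ≤ B

section Detection

lemma NeedsVSTATCalls.mono {X : Type} [MeasurableSpace X] {U : Measure X} {𝒟 : Set (Measure X)}
    {t : ℕ} {N N' : ℝ} (h : NeedsVSTATCalls U 𝒟 t N) (hN : N' ≤ N) : NeedsVSTATCalls U 𝒟 t N' :=
  fun Ω _ P _ alg q hq hsol => hN.trans (h Ω P alg q hq hsol)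

lemma NeedsOneSTATCalls.mono {X : Type} [MeasurableSpace X] {U : Measure X} {𝒟 : Set (Measure X)}
    {N N' : ℝ} (h : NeedsOneSTATCalls U 𝒟 N) (hN : N' ≤ N) : NeedsOneSTATCalls U 𝒟 N' :=
  fun Ω _ P _ alg q hq hsol => hN.trans (h Ω P alg q hq hsol)

/-- The lower bounds for a fixed `n`; `u` stands for `n ^ (δ / 2)`. -/
lemma detectionNeeds_of_hasTruncatedDensity {δ : ℝ} (hδ₀ : 0 < δ) (hδ₁ : δ ≤ 1 / 2) {n : ℕ} {L : ℝ}
    (hn : 16 ≤ n) (hL : 1 ≤ L) (hLn : L ≤ 2 * δ * Real.log n)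
    (hLn' : 2 * L ≤ δ ^ 2 * Real.log n) (hu : 1536 ≤ (n : ℝ) ^ (δ / 2))
    (M : PlantingModel) {m : ℝ} {σ₀ σ₁ : ℝ≥0}
    (hT : HasTruncatedDensity m σ₀ σ₁ (1 / (n : ℝ) ^ 2) (Real.exp L - 1)) :
    DetectionNeedsVSTAT M δ n m σ₀ σ₁ ((n : ℝ) ^ (δ ^ 2 * (Real.log n / L) - 1)) ∧
      DetectionNeedsOneSTAT M δ n m σ₀ σ₁ (1 / 32 * (n : ℝ) ^ (1 + δ)) := by
  have hn16 : (16 : ℝ) ≤ n := by exact_mod_cast hn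
  have hn0 : (0 : ℝ) < n := by linarith
  have hn1 : (1 : ℝ) ≤ n := by linarith
  have hL0 : 0 < L := by linarith
  obtain ⟨φ, Φ, hφ, hφ2, hφΦ, hΦ, h, hφ1, hloss, hB⟩ := hT
  set u : ℝ := (n : ℝ) ^ (δ / 2) with hu_def
  have hu0 : 0 < u := by linarith
  set k := plantSize δ n with hk_def
  set t := ⌈(n : ℝ) ^ (1 + δ)⌉₊ with ht_def
  have hu2 : (n : ℝ) ^ (1 + δ) = n * u ^ 2 := by
    rw [hu_def, ← Real.rpow_natCast, ← Real.rpow_mul hn0.le, Real.rpow_add hn0, Real.rpow_one]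
    congr 2
    push_cast
    ring
  have hu4 : (n : ℝ) ^ (2 * δ) = u ^ 4 := by
    rw [hu_def, ← Real.rpow_natCast, ← Real.rpow_mul hn0.le]
    congr 1
    push_cast
    ring
  have hone : (1 : ℝ) ≤ n * u ^ 2 := by nlinarith
  have htge : (n : ℝ) * u ^ 2 ≤ t := hu2 ▸ Nat.le_ceil _
  have htle : (t : ℝ) ≤ 2 * (n * u ^ 2) := by
    have h1 := Nat.ceil_lt_add_one (a := (n : ℝ) ^ (1 + δ)) (by positivity)
    rw [hu2] at h1
    rw [ht_def, hu2]
    linarith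
  have ht1 : 1 ≤ t := by
    have : (1 : ℝ) ≤ t := hone.trans htge
    exact_mod_cast this
  have ht0 : (0 : ℝ) < t := by exact_mod_cast ht1
  have hkle : (k : ℝ) ≤ (n : ℝ) ^ (1 / 2 - δ) := Nat.floor_le (by positivity)
  have hkn : k ≤ n := by
    have : (k : ℝ) ≤ n := hkle.trans
      ((Real.rpow_le_rpow_of_exponent_le hn1 (by linarith : 1 / 2 - δ ≤ 1)).trans_eq
        (Real.rpow_one _))
    exact_mod_cast this
  have hk2 : (k : ℝ) ^ 2 * u ^ 4 ≤ n := by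
    calc (k : ℝ) ^ 2 * u ^ 4 ≤ ((n : ℝ) ^ (1 / 2 - δ)) ^ 2 * u ^ 4 := by gcongr
      _ = (n : ℝ) ^ ((1 / 2 - δ) * 2 + 2 * δ) := by
          rw [Real.rpow_add hn0, hu4, Real.rpow_mul hn0.le]
          norm_cast
      _ = n := by
          rw [show (1 / 2 - δ) * 2 + 2 * δ = 1 by ring, Real.rpow_one]
  -- the second moment bound `X = exp L` satisfies `X ^ s = u`
  set s : ℝ := δ / 2 * (Real.log n / L) with hs_def
  have hXs : Real.exp L ^ s = u := by
    rw [← Real.exp_mul, hu_def, Real.rpow_def_of_pos hn0]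
    congr 1
    rw [hs_def]
    field_simp
  set N : ℝ := (n : ℝ) ^ (δ ^ 2 * (Real.log n / L)) with hN_def
  have hN0 : 0 < N := by positivity
  have hWs : (u ^ 4) ^ s = N := by
    rw [← hu4, ← Real.rpow_mul hn0.le, hN_def]
    congr 1
    rw [hs_def]
    ring
  have hX2 : 2 ≤ Real.exp L := by linarith [Real.add_one_le_exp L]
  have hXW : Real.exp L ≤ u ^ 4 := by
    rw [← hu4, Real.rpow_def_of_pos hn0]
    exact Real.exp_le_exp.2 (by linarith)
  have hκt : (t : ℝ) * ((k : ℝ) / n) ^ 2 * u ^ 2 ≤ 2 := by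
    rw [div_pow, mul_div_assoc', div_mul_eq_mul_div, div_le_iff₀ (by positivity)]
    calc (t : ℝ) * k ^ 2 * u ^ 2 ≤ 2 * (n * u ^ 2) * k ^ 2 * u ^ 2 := by gcongr
      _ = 2 * n * (k ^ 2 * u ^ 4) := by ring
      _ ≤ 2 * n * n := by gcongr
      _ = 2 * n ^ 2 := by ring
  have hκu : 1536 * ((t : ℝ) * ((k : ℝ) / n) ^ 2 * u) ≤ 2 := by
    calc 1536 * ((t : ℝ) * ((k : ℝ) / n) ^ 2 * u) ≤ u * ((t : ℝ) * ((k : ℝ) / n) ^ 2 * u) := by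
          gcongr
      _ = (t : ℝ) * ((k : ℝ) / n) ^ 2 * u ^ 2 := by ring
      _ ≤ 2 := hκt
  have hcard : ∀ f, Measurable f → ((distinguished (unplanted n σ₀)
      (fun S => planted n k m σ₀ σ₁ S M) t (Finset.powersetCard k Finset.univ) f).card : ℝ) ≤
      (Finset.powersetCard k (Finset.univ : Finset (Fin n))).card / N := by
    intro f hf
    refine (card_distinguished_planted_le (W := u ^ 4) (s := s) (by omega) hkn hφ hφ2 hφΦ hΦ h hφ1
      hX2 hB hXW ?_ ht1 ?_ ?_ ?_ M hf).trans ?_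
    · rw [mul_div_assoc', div_le_one hn0]
      linarith
    · calc 2 * n * (1 - ∫ y, φ y ∂gaussianReal 0 (σ₀ ^ 2)) ≤ 2 * n * (1 / (n : ℝ) ^ 2) := by gcongr
        _ = 2 / n := by field_simp
        _ ≤ 1 := by rw [div_le_one hn0]; linarith
    · refine hloss.trans (one_div_le_one_div_of_le (by positivity) ?_)
      have h1 : u ^ 2 ≤ √n := by
        have : u ^ 2 = (n : ℝ) ^ δ := by
          rw [hu_def, ← Real.rpow_natCast, ← Real.rpow_mul hn0.le]
          congr 1
          push_cast
          ring
        rw [this, Real.sqrt_eq_rpow]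
        exact Real.rpow_le_rpow_of_exponent_le hn1 hδ₁
      have h2 : 4 * √n ≤ n := by
        have h3 : 4 ≤ √(n : ℝ) := Real.le_sqrt_of_sq_le (by linarith)
        nlinarith [Real.sq_sqrt hn0.le]
      nlinarith
    · rw [hXs, le_div_iff₀ (by positivity)]
      linarith
    · rw [Real.div_rpow (Real.exp_pos L).le (by positivity), hXs, hWs, Finset.card_powersetCard,
        Finset.card_univ, Fintype.card_fin, ← mul_div_assoc, div_mul_eq_mul_div, ← mul_div_assoc]
      refine div_le_div_of_nonneg_right ?_ hN0.le
      have h1 : (768 : ℝ) * (t * ((k : ℝ) / n) ^ 2 * u) ≤ 1 := by linarith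
      calc 128 * (t : ℝ) * (6 * ((k : ℝ) / n) ^ 2 * u * ((n.choose k : ℕ) : ℝ))
          = (768 * (t * ((k : ℝ) / n) ^ 2 * u)) * ((n.choose k : ℕ) : ℝ) := by ring
        _ ≤ 1 * ((n.choose k : ℕ) : ℝ) := mul_le_mul_of_nonneg_right h1 (Nat.cast_nonneg _)
        _ = _ := one_mul _
  have hI : (Finset.powersetCard k (Finset.univ : Finset (Fin n))).Nonempty :=
    Finset.powersetCard_nonempty.2 (by simpa using hkn)
  have hmem : ∀ S ∈ Finset.powersetCard k (Finset.univ : Finset (Fin n)),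
      planted n k m σ₀ σ₁ S M ∈ plantedFamily M n k m σ₀ σ₁ :=
    fun S hS => ⟨S, (Finset.mem_powersetCard.1 hS).2, rfl⟩
  constructor
  · refine (needsVSTATCalls_of_card_distinguished_le hI hN0 hmem hcard).mono ?_
    rw [Real.rpow_sub hn0, Real.rpow_one]
    exact div_le_div_of_nonneg_left hN0.le (by norm_num) (by linarith)
  · have hNt : (t : ℝ) / 8 ≤ N := by
      have h1 : (n : ℝ) ^ (2 : ℝ) ≤ N := by
        refine Real.rpow_le_rpow_of_exponent_le hn1 ?_
        rw [← mul_div_assoc, le_div_iff₀ hL0]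
        linarith
      have h2 : (n : ℝ) ^ (1 + δ) ≤ (n : ℝ) ^ (2 : ℝ) :=
        Real.rpow_le_rpow_of_exponent_le hn1 (by linarith)
      linarith
    refine (needsOneSTATCalls_of_card_distinguished_le
      (fun S => isProbabilityMeasure_planted hkn S M) hI hN0 ht1 hNt hmem hcard).mono ?_
    rw [hu2]
    linarith

/-- A truncated second moment of size `n ^ o(1)` implies the lower bounds for detection. -/
theorem eventually_detectionNeeds {δ : ℝ} (hδ₀ : 0 < δ) (hδ₁ : δ ≤ 1 / 2) {L : ℕ → ℝ}
    (hL : ∀ n, 1 ≤ L n) (hLo : Tendsto (fun n : ℕ => L n / Real.log n) atTop (𝓝 0)) :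
    ∀ᶠ n : ℕ in atTop, ∀ (M : PlantingModel) (m : ℝ) (σ₀ σ₁ : ℝ≥0),
      HasTruncatedDensity m σ₀ σ₁ (1 / (n : ℝ) ^ 2) (Real.exp (L n) - 1) →
      DetectionNeedsVSTAT M δ n m σ₀ σ₁ ((n : ℝ) ^ (δ ^ 2 * (Real.log n / L n) - 1)) ∧
        DetectionNeedsOneSTAT M δ n m σ₀ σ₁ (1 / 32 * (n : ℝ) ^ (1 + δ)) := by
  have hu : Tendsto (fun n : ℕ => (n : ℝ) ^ (δ / 2)) atTop atTop :=
    (tendsto_rpow_atTop (by positivity)).comp tendsto_natCast_atTop_atTop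
  filter_upwards [eventually_ge_atTop 16, hu.eventually_ge_atTop 1536,
    hLo.eventually_lt_const (u := 2 * δ) (by positivity),
    hLo.eventually_lt_const (u := δ ^ 2 / 2) (by positivity)] with n hn hun h1 h2 M m σ₀ σ₁ hT
  have hlog : 0 < Real.log n := Real.log_pos (by exact_mod_cast (by omega : 1 < n))
  rw [div_lt_iff₀ hlog] at h1 h2
  exact detectionNeeds_of_hasTruncatedDensity hδ₀ hδ₁ hn (hL n) h1.le (by linarith) hun M hT

/-- The exponent of the lower bound for `VSTAT` tends to infinity. -/
lemma tendsto_exponent {δ : ℝ} (hδ₀ : 0 < δ) {L : ℕ → ℝ} (hL : ∀ n, 1 ≤ L n)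
    (hLo : Tendsto (fun n : ℕ => L n / Real.log n) atTop (𝓝 0)) :
    Tendsto (fun n : ℕ => δ ^ 2 * (Real.log n / L n) - 1) atTop atTop := by
  have h1 : Tendsto (fun n : ℕ => Real.log n / L n) atTop atTop := by
    have h2 : Tendsto (fun n : ℕ => L n / Real.log n) atTop (𝓝[>] 0) := by
      refine tendsto_nhdsWithin_iff.2 ⟨hLo, ?_⟩
      filter_upwards [eventually_ge_atTop 2] with n hn
      have hlog : 0 < Real.log n := Real.log_pos (by exact_mod_cast (by omega : 1 < n))
      exact div_pos (by linarith [hL n]) hlog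
    refine h2.inv_tendsto_nhdsGT_zero.congr fun n => ?_
    simp
  exact tendsto_atTop_add_const_right _ _ (h1.const_mul_atTop (by positivity))

end Detection

/-! ### Truncated second moments of Gaussian density ratios -/

section Gaussian

lemma HasTruncatedDensity.mono {m : ℝ} {σ₀ σ₁ : ℝ≥0} {loss loss' B B' : ℝ}
    (h : HasTruncatedDensity m σ₀ σ₁ loss B) (hl : loss ≤ loss') (hB : B ≤ B') :
    HasTruncatedDensity m σ₀ σ₁ loss' B' := by
  obtain ⟨φ, Φ, h1, h2, h3, h4, h5, h6, h7, h8⟩ := h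
  exact ⟨φ, Φ, h1, h2, h3, h4, h5, h6, h7.trans hl, h8.trans hB⟩

lemma integrable_gaussianReal_iff {v : ℝ≥0} (hv : v ≠ 0) (μ : ℝ) (f : ℝ → ℝ) :
    Integrable f (gaussianReal μ v) ↔ Integrable fun x => gaussianPDFReal μ v x * f x := by
  rw [gaussianReal_of_var_ne_zero μ hv,
    integrable_withDensity_iff_integrable_smul' (measurable_gaussianPDF μ v)
      (ae_of_all _ fun _ => gaussianPDF_lt_top)]
  simp [toReal_gaussianPDF]

/-- Truncation of the density ratio to a set `A`. -/
lemma hasTruncatedDensity_of_set {m : ℝ} {σ₀ σ₁ : ℝ≥0} (h₀ : 0 < σ₀) (h₁ : 0 < σ₁) {A : Set ℝ}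
    (hA : MeasurableSet A) {loss B : ℝ}
    (hint : IntegrableOn
      (fun x => gaussianPDFReal m (σ₁ ^ 2) x ^ 2 / gaussianPDFReal 0 (σ₀ ^ 2) x) A)
    (hloss : (gaussianReal m (σ₁ ^ 2)).real Aᶜ ≤ loss)
    (hB : ∫ x in A, gaussianPDFReal m (σ₁ ^ 2) x ^ 2 / gaussianPDFReal 0 (σ₀ ^ 2) x ≤ B) :
    HasTruncatedDensity m σ₀ σ₁ loss B := by
  have hv₀ : σ₀ ^ 2 ≠ 0 := (pow_pos h₀ 2).ne'
  have hv₁ : σ₁ ^ 2 ≠ 0 := (pow_pos h₁ 2).ne'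
  set p₀ := gaussianPDFReal 0 (σ₀ ^ 2) with hp₀
  set p₁ := gaussianPDFReal m (σ₁ ^ 2) with hp₁
  have hpos₀ : ∀ x, 0 < p₀ x := fun x => gaussianPDFReal_pos 0 _ x hv₀
  have hnn₁ : ∀ x, 0 ≤ p₁ x := fun x => gaussianPDFReal_nonneg m _ x
  have hm₀ : Measurable p₀ := measurable_gaussianPDFReal _ _
  have hm₁ : Measurable p₁ := measurable_gaussianPDFReal _ _
  set φ : ℝ → ℝ := A.indicator fun x => p₁ x / p₀ x with hφ
  have hφm : Measurable φ := (hm₁.div hm₀).indicator hA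
  have e1 : ∀ x, p₀ x * φ x = A.indicator p₁ x := by
    intro x
    by_cases hx : x ∈ A
    · simp only [hφ, Set.indicator_of_mem hx]
      exact mul_div_cancel₀ _ (hpos₀ x).ne'
    · simp [hφ, hx]
  have e2 : ∀ x, p₀ x * φ x ^ 2 = A.indicator (fun x => p₁ x ^ 2 / p₀ x) x := by
    intro x
    by_cases hx : x ∈ A
    · simp only [hφ, Set.indicator_of_mem hx]
      have := (hpos₀ x).ne'
      field_simp
    · simp [hφ, hx]
  have hmean : ∫ y, φ y ∂gaussianReal 0 (σ₀ ^ 2) = (gaussianReal m (σ₁ ^ 2)).real A := by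
    rw [integral_gaussianReal_eq_integral_smul hv₀]
    simp only [smul_eq_mul, ← hp₀, e1]
    rw [integral_indicator hA, measureReal_def, gaussianReal_apply_eq_integral m hv₁,
      ENNReal.toReal_ofReal (integral_nonneg fun x => hnn₁ x)]
  have hΦm : Measurable fun x => gaussianPDF m (σ₁ ^ 2) x / gaussianPDF 0 (σ₀ ^ 2) x :=
    (measurable_gaussianPDF _ _).div (measurable_gaussianPDF _ _)
  refine ⟨φ, fun x => gaussianPDF m (σ₁ ^ 2) x / gaussianPDF 0 (σ₀ ^ 2) x,
    fun y => Set.indicator_nonneg (fun x _ => div_nonneg (hnn₁ x) (hpos₀ x).le) y, ?_, fun y => ?_,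
    hΦm, ?_, ?_, ?_, ?_⟩
  · rw [memLp_two_iff_integrable_sq hφm.aestronglyMeasurable, integrable_gaussianReal_iff hv₀]
    simp_rw [← hp₀, e2]
    exact (integrable_indicator_iff hA).2 hint
  · by_cases hy : y ∈ A
    · simp only [hφ, Set.indicator_of_mem hy]
      rw [ENNReal.ofReal_div_of_pos (hpos₀ y)]
      rfl
    · simp [hφ, hy]
  · rw [gaussianReal_of_var_ne_zero 0 hv₀, gaussianReal_of_var_ne_zero m hv₁,
      ← withDensity_mul _ (measurable_gaussianPDF _ _) hΦm]
    congr 1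
    ext x
    exact (ENNReal.mul_div_cancel (gaussianPDF_pos 0 hv₀ x).ne' gaussianPDF_ne_top).symm
  · rw [hmean]
    exact measureReal_le_one
  · rw [hmean, ← probReal_compl_eq_one_sub hA]
    exact hloss
  · rw [integral_gaussianReal_eq_integral_smul hv₀]
    simp only [smul_eq_mul, ← hp₀, e2]
    rwa [integral_indicator hA]

lemma gaussianPDFReal_zero_sq_div {σ₀ σ₁ : ℝ≥0} (h₀ : 0 < σ₀) (h₁ : 0 < σ₁) (x : ℝ) :
    gaussianPDFReal 0 (σ₁ ^ 2) x ^ 2 / gaussianPDFReal 0 (σ₀ ^ 2) x =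
      σ₀ / (σ₁ ^ 2 * √(2 * Real.pi)) *
        Real.exp (-(1 / (σ₁ : ℝ) ^ 2 - 1 / (2 * (σ₀ : ℝ) ^ 2)) * x ^ 2) := by
  have h0 : (0 : ℝ) < σ₀ := h₀
  have h1 : (0 : ℝ) < σ₁ := h₁
  have hpi : 0 < √(2 * Real.pi) := Real.sqrt_pos.2 (by positivity)
  have hsqrt : ∀ s : ℝ, 0 ≤ s → √(2 * Real.pi * s ^ 2) = √(2 * Real.pi) * s := fun s hs => by
    rw [Real.sqrt_mul (by positivity), Real.sqrt_sq hs]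
  simp only [gaussianPDFReal, NNReal.coe_pow, sub_zero]
  rw [hsqrt _ h1.le, hsqrt _ h0.le]
  generalize √(2 * Real.pi) = w at hpi
  rw [mul_pow, ← Real.exp_nat_mul, mul_div_mul_comm, ← Real.exp_sub]
  congr 1
  · field_simp
  · congr 1
    field_simp
    push_cast
    ring

/-- The ratio is square integrable when the variance ratio stays below `2`. -/
lemma hasTruncatedDensity_of_le_two_mul {c ε : ℝ} (hc : 0 < c) (hε : 0 < ε) {σ₀ σ₁ : ℝ≥0}
    (h₀ : 0 < σ₀) (hlow : c * (σ₀ : ℝ) ^ 2 ≤ (σ₁ : ℝ) ^ 2)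
    (hup : (σ₁ : ℝ) ^ 2 ≤ 2 * (σ₀ : ℝ) ^ 2 * (1 - ε)) :
    HasTruncatedDensity 0 σ₀ σ₁ 0 (1 / (c * √ε)) := by
  have h0 : (0 : ℝ) < σ₀ := h₀
  have hv1 : 0 < (σ₁ : ℝ) ^ 2 := lt_of_lt_of_le (by positivity) hlow
  have h1 : (0 : ℝ) < σ₁ := by
    refine lt_of_le_of_ne σ₁.2 fun h => ?_
    rw [← h] at hv1
    simp at hv1
  have h₁ : 0 < σ₁ := h1
  set b : ℝ := ε / (2 * (σ₀ : ℝ) ^ 2) with hb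
  have hb0 : 0 < b := by positivity
  set K : ℝ := σ₀ / (σ₁ ^ 2 * √(2 * Real.pi)) with hK
  have hK0 : 0 ≤ K := by positivity
  have hexp : b ≤ 1 / (σ₁ : ℝ) ^ 2 - 1 / (2 * (σ₀ : ℝ) ^ 2) := by
    rw [hb, div_sub_div _ _ hv1.ne' (by positivity),
      div_le_div_iff₀ (by positivity) (by positivity)]
    have : (σ₁ : ℝ) ^ 2 * (1 + ε) ≤ 2 * (σ₀ : ℝ) ^ 2 := by
      nlinarith [mul_le_mul_of_nonneg_right hup (by linarith : 0 ≤ 1 + ε),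
        mul_nonneg (sq_nonneg (σ₀ : ℝ)) (sq_nonneg ε)]
    nlinarith [sq_nonneg (σ₀ : ℝ)]
  have hint : Integrable fun x : ℝ => K * Real.exp (-b * x ^ 2) :=
    (integrable_exp_neg_mul_sq hb0).const_mul K
  have hle : ∀ x : ℝ, gaussianPDFReal 0 (σ₁ ^ 2) x ^ 2 / gaussianPDFReal 0 (σ₀ ^ 2) x ≤
      K * Real.exp (-b * x ^ 2) := by
    intro x
    rw [gaussianPDFReal_zero_sq_div h₀ h₁]
    refine mul_le_mul_of_nonneg_left (Real.exp_le_exp.2 ?_) hK0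
    nlinarith [sq_nonneg x]
  have hnn : ∀ x : ℝ, 0 ≤ gaussianPDFReal 0 (σ₁ ^ 2) x ^ 2 / gaussianPDFReal 0 (σ₀ ^ 2) x :=
    fun x => div_nonneg (sq_nonneg _) (gaussianPDFReal_nonneg _ _ _)
  have hint' : Integrable fun x : ℝ =>
      gaussianPDFReal 0 (σ₁ ^ 2) x ^ 2 / gaussianPDFReal 0 (σ₀ ^ 2) x := by
    refine hint.mono' (((measurable_gaussianPDFReal _ _).pow_const 2).div
      (measurable_gaussianPDFReal _ _)).aestronglyMeasurable (ae_of_all _ fun x => ?_)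
    rw [Real.norm_of_nonneg (hnn x)]
    exact hle x
  refine hasTruncatedDensity_of_set h₀ h₁ MeasurableSet.univ hint'.integrableOn (by simp) ?_
  rw [setIntegral_univ]
  refine (integral_mono hint' hint hle).trans ?_
  rw [integral_const_mul, integral_gaussian]
  have e : √(Real.pi / b) = √(2 * Real.pi) * σ₀ / √ε := by
    rw [hb, show Real.pi / (ε / (2 * (σ₀ : ℝ) ^ 2)) = 2 * Real.pi * (σ₀ : ℝ) ^ 2 / ε by
      field_simp, Real.sqrt_div' _ hε.le, Real.sqrt_mul (by positivity), Real.sqrt_sq h0.le]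
  have hpi : 0 < √(2 * Real.pi) := Real.sqrt_pos.2 (by positivity)
  have hsε : 0 < √ε := Real.sqrt_pos.2 hε
  have e' : K * √(Real.pi / b) = (σ₀ : ℝ) ^ 2 / (σ₁ ^ 2 * √ε) := by
    rw [e, hK]
    field_simp
  rw [e', div_le_div_iff₀ (by positivity) (by positivity)]
  nlinarith

lemma measureReal_gaussianReal_abs_gt_le {v : ℝ≥0} (hv : 0 < v) {a : ℝ} (ha : 0 ≤ a) :
    (gaussianReal 0 v).real {x | a < |x|} ≤ 2 * Real.exp (-(a ^ 2 / (2 * v))) := by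
  have hv' : (0 : ℝ) < v := hv
  have hexp : ∀ s : ℝ, s ^ 2 = (a / v) ^ 2 → -(a / v * a) + v * s ^ 2 / 2 = -(a ^ 2 / (2 * v)) := by
    intro s hs
    rw [hs]
    field_simp
    ring
  have h1 : (gaussianReal 0 v).real {x | a ≤ id x} ≤ Real.exp (-(a ^ 2 / (2 * v))) := by
    refine (measure_ge_le_exp_mul_mgf (X := id) a (by positivity : 0 ≤ a / v)
      (integrable_exp_mul_gaussianReal _)).trans (le_of_eq ?_)
    rw [mgf_id_gaussianReal, ← Real.exp_add, ← hexp (a / v) rfl]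
    congr 1
    ring
  have h2 : (gaussianReal 0 v).real {x | id x ≤ -a} ≤ Real.exp (-(a ^ 2 / (2 * v))) := by
    refine (measure_le_le_exp_mul_mgf (X := id) (-a) (by simp; positivity : -(a / v) ≤ 0)
      (integrable_exp_mul_gaussianReal _)).trans (le_of_eq ?_)
    rw [mgf_id_gaussianReal, ← Real.exp_add, ← hexp (-(a / v)) (by ring)]
    congr 1
    ring
  have hsub : {x : ℝ | a < |x|} ⊆ {x | a ≤ id x} ∪ {x | id x ≤ -a} := by
    intro x hx
    rcases lt_abs.1 (show a < |x| from hx) with h | h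
    · exact Or.inl h.le
    · exact Or.inr (by simp only [Set.mem_ofPred_eq, id]; linarith)
  calc _ ≤ (gaussianReal 0 v).real ({x | a ≤ id x} ∪ {x | id x ≤ -a}) := measureReal_mono hsub
    _ ≤ _ := (measureReal_union_le _ _).trans (by linarith)

/-- When the variance ratio may reach or slightly exceed `2`, the density ratio is truncated
at `ρ` standard deviations. -/
lemma hasTruncatedDensity_of_le_two_add {c α ρ : ℝ} (hc : 0 < c) (hα : |α| ≤ 1) (hρ : 0 ≤ ρ)
    {σ₀ σ₁ : ℝ≥0} (h₀ : 0 < σ₀) (hlow : c * (σ₀ : ℝ) ^ 2 ≤ (σ₁ : ℝ) ^ 2)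
    (hup : (σ₁ : ℝ) ^ 2 ≤ (2 + α) * (σ₀ : ℝ) ^ 2) :
    HasTruncatedDensity 0 σ₀ σ₁ (2 * Real.exp (-(ρ ^ 2 / 6)))
      (ρ / c * Real.exp (|α| * ρ ^ 2 / 4)) := by
  have h0 : (0 : ℝ) < σ₀ := h₀
  have hv1 : 0 < (σ₁ : ℝ) ^ 2 := lt_of_lt_of_le (by positivity) hlow
  have h1 : (0 : ℝ) < σ₁ := by
    refine lt_of_le_of_ne σ₁.2 fun h => ?_
    rw [← h] at hv1
    simp at hv1
  have h₁ : 0 < σ₁ := h1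
  have hv0 : 0 < (σ₀ : ℝ) ^ 2 := by positivity
  obtain ⟨hα1, hα2⟩ := abs_le.1 hα
  set K : ℝ := σ₀ / (σ₁ ^ 2 * √(2 * Real.pi)) with hK
  have hK0 : 0 ≤ K := by positivity
  set A : Set ℝ := Set.Icc (-(ρ * σ₀)) (ρ * σ₀) with hA
  have hexp : 1 / (2 * (σ₀ : ℝ) ^ 2) - 1 / (σ₁ : ℝ) ^ 2 ≤ |α| / (4 * (σ₀ : ℝ) ^ 2) := by
    rw [div_sub_div _ _ (by positivity) hv1.ne', div_le_div_iff₀ (by positivity) (by positivity)]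
    have h2 : (σ₁ : ℝ) ^ 2 ≤ (2 + |α|) * (σ₀ : ℝ) ^ 2 :=
      hup.trans (by nlinarith [le_abs_self α])
    rcases le_total ((σ₁ : ℝ) ^ 2) (2 * (σ₀ : ℝ) ^ 2) with h3 | h3
    · have h4 : (1 * (σ₁ : ℝ) ^ 2 - 2 * (σ₀ : ℝ) ^ 2 * 1) * (4 * (σ₀ : ℝ) ^ 2) ≤ 0 :=
        mul_nonpos_of_nonpos_of_nonneg (by linarith) (by positivity)
      exact h4.trans (by positivity)
    · have h4 : |α| * (2 * (σ₀ : ℝ) ^ 2) ≤ |α| * (σ₁ : ℝ) ^ 2 :=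
        mul_le_mul_of_nonneg_left h3 (abs_nonneg α)
      calc (1 * (σ₁ : ℝ) ^ 2 - 2 * (σ₀ : ℝ) ^ 2 * 1) * (4 * (σ₀ : ℝ) ^ 2)
          ≤ (|α| * (σ₀ : ℝ) ^ 2) * (4 * (σ₀ : ℝ) ^ 2) :=
            mul_le_mul_of_nonneg_right (by linarith) (by positivity)
        _ = (|α| * (2 * (σ₀ : ℝ) ^ 2)) * (2 * (σ₀ : ℝ) ^ 2) := by ring
        _ ≤ (|α| * (σ₁ : ℝ) ^ 2) * (2 * (σ₀ : ℝ) ^ 2) :=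
            mul_le_mul_of_nonneg_right h4 (by positivity)
        _ = _ := by ring
  have hle : ∀ x ∈ A, gaussianPDFReal 0 (σ₁ ^ 2) x ^ 2 / gaussianPDFReal 0 (σ₀ ^ 2) x ≤
      K * Real.exp (|α| * ρ ^ 2 / 4) := by
    intro x hx
    rw [gaussianPDFReal_zero_sq_div h₀ h₁]
    refine mul_le_mul_of_nonneg_left (Real.exp_le_exp.2 ?_) hK0
    have hx2 : x ^ 2 ≤ (ρ * σ₀) ^ 2 := sq_le_sq' hx.1 hx.2
    calc _ = (1 / (2 * (σ₀ : ℝ) ^ 2) - 1 / (σ₁ : ℝ) ^ 2) * x ^ 2 := by ring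
      _ ≤ |α| / (4 * (σ₀ : ℝ) ^ 2) * x ^ 2 := mul_le_mul_of_nonneg_right hexp (sq_nonneg x)
      _ ≤ |α| / (4 * (σ₀ : ℝ) ^ 2) * (ρ * σ₀) ^ 2 := mul_le_mul_of_nonneg_left hx2 (by positivity)
      _ = _ := by field_simp
  have hnn : ∀ x : ℝ, 0 ≤ gaussianPDFReal 0 (σ₁ ^ 2) x ^ 2 / gaussianPDFReal 0 (σ₀ ^ 2) x :=
    fun x => div_nonneg (sq_nonneg _) (gaussianPDFReal_nonneg _ _ _)
  have hconst : IntegrableOn (fun _ : ℝ => K * Real.exp (|α| * ρ ^ 2 / 4)) A :=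
    integrableOn_const (by simp [hA])
  have hint : IntegrableOn (fun x : ℝ =>
      gaussianPDFReal 0 (σ₁ ^ 2) x ^ 2 / gaussianPDFReal 0 (σ₀ ^ 2) x) A := by
    refine hconst.mono' (((measurable_gaussianPDFReal _ _).pow_const 2).div
      (measurable_gaussianPDFReal _ _)).aestronglyMeasurable ?_
    filter_upwards [ae_restrict_mem measurableSet_Icc] with x hx
    rw [Real.norm_of_nonneg (hnn x)]
    exact hle x hx
  refine hasTruncatedDensity_of_set h₀ h₁ measurableSet_Icc hint ?_ ?_
  · have hcompl : Aᶜ ⊆ {x | ρ * σ₀ < |x|} := by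
      intro x hx
      by_contra h
      exact hx (abs_le.1 (not_lt.1 h))
    refine (measureReal_mono hcompl).trans ((measureReal_gaussianReal_abs_gt_le (pow_pos h₁ 2)
      (by positivity)).trans ?_)
    refine mul_le_mul_of_nonneg_left (Real.exp_le_exp.2 (neg_le_neg ?_)) zero_le_two
    rw [NNReal.coe_pow, div_le_div_iff₀ (by norm_num) (by positivity)]
    have h3 : (σ₁ : ℝ) ^ 2 ≤ 3 * (σ₀ : ℝ) ^ 2 := hup.trans (by nlinarith)
    nlinarith [mul_le_mul_of_nonneg_left h3 (sq_nonneg ρ)]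
  · refine (setIntegral_mono_on hint hconst measurableSet_Icc hle).trans ?_
    rw [setIntegral_const, smul_eq_mul, hA, Real.volume_real_Icc_of_le (by nlinarith)]
    have hpi : 2 ≤ √(2 * Real.pi) := Real.le_sqrt_of_sq_le (by nlinarith [Real.pi_gt_three])
    rw [← mul_assoc]
    refine mul_le_mul_of_nonneg_right ?_ (Real.exp_pos _).le
    rw [hK, mul_div_assoc', div_le_div_iff₀ (by positivity) hc]
    have h3 : c * (σ₀ : ℝ) ^ 2 * 2 ≤ (σ₁ : ℝ) ^ 2 * √(2 * Real.pi) :=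
      mul_le_mul hlow hpi (by norm_num) hv1.le
    calc (ρ * σ₀ - -(ρ * σ₀)) * σ₀ * c = ρ * (c * (σ₀ : ℝ) ^ 2 * 2) := by ring
      _ ≤ _ := mul_le_mul_of_nonneg_left h3 hρ

/-- The second moment of the density ratio for equal variances. -/
lemma hasTruncatedDensity_shift (m : ℝ) {σ : ℝ≥0} (hσ : 0 < σ) :
    HasTruncatedDensity m σ σ 0 (Real.exp (m ^ 2 / (σ : ℝ) ^ 2)) := by
  have h0 : (0 : ℝ) < σ := hσ
  have hv : σ ^ 2 ≠ 0 := (pow_pos hσ 2).ne'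
  have e : ∀ x, gaussianPDFReal m (σ ^ 2) x ^ 2 / gaussianPDFReal 0 (σ ^ 2) x =
      Real.exp (m ^ 2 / (σ : ℝ) ^ 2) * gaussianPDFReal (2 * m) (σ ^ 2) x := by
    intro x
    rw [div_eq_iff (gaussianPDFReal_pos _ _ _ hv).ne']
    simp only [gaussianPDFReal, NNReal.coe_pow, sub_zero]
    rw [mul_pow, ← Real.exp_nat_mul]
    have : Real.exp ((2 : ℕ) * (-(x - m) ^ 2 / (2 * (σ : ℝ) ^ 2))) =
        Real.exp (m ^ 2 / (σ : ℝ) ^ 2) * Real.exp (-(x - 2 * m) ^ 2 / (2 * (σ : ℝ) ^ 2)) *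
          Real.exp (-x ^ 2 / (2 * (σ : ℝ) ^ 2)) := by
      rw [← Real.exp_add, ← Real.exp_add]
      congr 1
      field_simp
      push_cast
      ring
    rw [this]
    ring
  refine hasTruncatedDensity_of_set hσ hσ MeasurableSet.univ ?_ (by simp) ?_
  · simp_rw [e]
    exact ((integrable_gaussianPDFReal _ _).const_mul _).integrableOn
  · simp_rw [e]
    rw [setIntegral_univ, integral_const_mul, integral_gaussianPDFReal_eq_one _ hv, mul_one]

end Gaussian

/-! ### The four parameter regimes -/

section Regimes

lemma DetectionNeedsVSTAT.rpow_mono {M : PlantingModel} {δ : ℝ} {n : ℕ} {m : ℝ} {σ₀ σ₁ : ℝ≥0}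
    {x y : ℝ} (h : DetectionNeedsVSTAT M δ n m σ₀ σ₁ ((n : ℝ) ^ y)) (hn : 1 ≤ n) (hxy : x ≤ y) :
    DetectionNeedsVSTAT M δ n m σ₀ σ₁ ((n : ℝ) ^ x) :=
  h.mono (Real.rpow_le_rpow_of_exponent_le (by exact_mod_cast hn) hxy)

lemma tendsto_log_natCast_atTop : Tendsto (fun n : ℕ => Real.log n) atTop atTop :=
  Real.tendsto_log_atTop.comp tendsto_natCast_atTop_atTop

lemma tendsto_one_add_div_log {g : ℕ → ℝ}
    (hg : Tendsto (fun n : ℕ => g n / Real.log n) atTop (𝓝 0)) :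
    Tendsto (fun n : ℕ => (1 + g n) / Real.log n) atTop (𝓝 0) := by
  have h1 : Tendsto (fun n : ℕ => 1 / Real.log n) atTop (𝓝 0) :=
    tendsto_const_nhds.div_atTop tendsto_log_natCast_atTop
  simpa [add_div] using h1.add hg

/-- The logarithm of the bound on the truncated second moment for variance ratios up to
`2 + α n`, truncating at `√(18 log n)` standard deviations. -/
noncomputable def truncationExponent (α : ℕ → ℝ) (n : ℕ) : ℝ :=
  1 + (|Real.log (Real.log n)| + 5 * |α n| * Real.log n)

lemma one_le_truncationExponent (α : ℕ → ℝ) (n : ℕ) : 1 ≤ truncationExponent α n := by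
  have := Real.log_natCast_nonneg n
  have : 0 ≤ |Real.log (Real.log n)| + 5 * |α n| * Real.log n := by positivity
  unfold truncationExponent
  linarith

lemma tendsto_truncationExponent_div_log {α : ℕ → ℝ} (hα : Tendsto α atTop (𝓝 0)) :
    Tendsto (fun n : ℕ => truncationExponent α n / Real.log n) atTop (𝓝 0) := by
  refine tendsto_one_add_div_log ?_
  have h1 : Tendsto (fun n : ℕ => |Real.log (Real.log n)| / Real.log n) atTop (𝓝 0) := by
    have := (Real.isLittleO_log_id_atTop.comp_tendsto
      tendsto_log_natCast_atTop).tendsto_div_nhds_zero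
    refine (tendsto_zero_iff_norm_tendsto_zero.1 this).congr fun n => ?_
    simp [abs_of_nonneg (Real.log_natCast_nonneg n)]
  have h2 : Tendsto (fun n : ℕ => 5 * |α n|) atTop (𝓝 0) := by
    simpa using (hα.abs).const_mul 5
  have h3 := h1.add h2
  rw [add_zero] at h3
  refine h3.congr' ?_
  filter_upwards [tendsto_log_natCast_atTop.eventually_gt_atTop 0] with n hn
  field_simp

lemma eventually_hasTruncatedDensity {c : ℝ} {α : ℕ → ℝ} (hc : 0 < c)
    (hα : Tendsto α atTop (𝓝 0)) :
    ∀ᶠ n : ℕ in atTop, ∀ σ₀ σ₁ : ℝ≥0, 0 < σ₀ → c * (σ₀ : ℝ) ^ 2 ≤ (σ₁ : ℝ) ^ 2 →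
      (σ₁ : ℝ) ^ 2 ≤ (2 + α n) * (σ₀ : ℝ) ^ 2 →
      HasTruncatedDensity 0 σ₀ σ₁ (1 / (n : ℝ) ^ 2) (Real.exp (truncationExponent α n) - 1) := by
  have hα1 : ∀ᶠ n in atTop, |α n| < 1 := by
    have := hα.abs
    rw [abs_zero] at this
    exact this.eventually_lt_const one_pos
  filter_upwards [eventually_ge_atTop 2, hα1, tendsto_log_natCast_atTop.eventually_ge_atTop 1,
    tendsto_log_natCast_atTop.eventually_ge_atTop (18 / c ^ 2)]
    with n hn hαn hlog hlogc σ₀ σ₁ h₀ hlow hup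
  have hn2 : (2 : ℝ) ≤ n := by exact_mod_cast hn
  have hlog0 : 0 < Real.log n := by linarith
  set ρ : ℝ := √(18 * Real.log n) with hρ
  have hρ2 : ρ ^ 2 = 18 * Real.log n := Real.sq_sqrt (by positivity)
  refine (hasTruncatedDensity_of_le_two_add (ρ := ρ) hc hαn.le (Real.sqrt_nonneg _) h₀ hlow
    hup).mono ?_ ?_
  · have e : Real.exp (-(ρ ^ 2 / 6)) = 1 / (n : ℝ) ^ 3 := by
      rw [hρ2, show -(18 * Real.log n / 6) = -((3 : ℕ) * Real.log n) by push_cast; ring,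
        Real.exp_neg, Real.exp_nat_mul, Real.exp_log (by positivity), one_div]
    rw [e, mul_one_div, div_le_div_iff₀ (by positivity) (by positivity)]
    nlinarith [sq_nonneg (n : ℝ)]
  · have h1 : ρ / c ≤ Real.log n := by
      rw [div_le_iff₀ hc]
      refine Real.sqrt_le_iff.2 ⟨by positivity, ?_⟩
      rw [div_le_iff₀ (by positivity)] at hlogc
      nlinarith
    have h2 : |α n| * ρ ^ 2 / 4 ≤ 5 * |α n| * Real.log n := by
      rw [hρ2]
      nlinarith [mul_nonneg (abs_nonneg (α n)) hlog0.le]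
    have h3 : 2 * (Real.log n * Real.exp (5 * |α n| * Real.log n)) ≤
        Real.exp (truncationExponent α n) := by
      rw [truncationExponent, Real.exp_add, Real.exp_add]
      have h4 : Real.log n ≤ Real.exp |Real.log (Real.log n)| :=
        (Real.exp_log hlog0).symm.le.trans (Real.exp_le_exp.2 (le_abs_self _))
      have h5 : (2 : ℝ) ≤ Real.exp 1 := by linarith [Real.add_one_le_exp (1 : ℝ)]
      gcongr
    have h6 : 1 ≤ Real.log n * Real.exp (5 * |α n| * Real.log n) :=
      one_le_mul_of_one_le_of_one_le hlog (Real.one_le_exp (by positivity))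
    calc ρ / c * Real.exp (|α n| * ρ ^ 2 / 4)
        ≤ Real.log n * Real.exp (5 * |α n| * Real.log n) := by gcongr
      _ ≤ _ := by linarith

/-- For means of order `o(σ √(log (√n / k)))` the second moment is `n ^ o(1)`. -/
lemma tendsto_sq_div_sq_div_log {δ : ℝ} (hδ₀ : 0 < δ) (hδ₁ : δ ≤ 1 / 2) {m : ℕ → ℝ} {σ : ℕ → ℝ≥0}
    (hσ : ∀ n, 0 < σ n)
    (hm : (fun n => m n ^ 2) =o[atTop]
      (fun n => (σ n : ℝ) ^ 2 * Real.log (Real.sqrt n / plantSize δ n))) :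
    Tendsto (fun n : ℕ => m n ^ 2 / (σ n : ℝ) ^ 2 / Real.log n) atTop (𝓝 0) := by
  refine IsLittleO.tendsto_div_nhds_zero (isLittleO_iff.2 fun ε hε => ?_)
  filter_upwards [isLittleO_iff.1 hm hε, eventually_ge_atTop 1] with n h1 hn
  have hn1 : (1 : ℝ) ≤ n := by exact_mod_cast hn
  have hn0 : (0 : ℝ) < n := by linarith
  have hσn : (0 : ℝ) < σ n := hσ n
  have hk1 : (1 : ℝ) ≤ plantSize δ n := by
    have : 1 ≤ plantSize δ n :=
      Nat.le_floor (by rw [Nat.cast_one]; exact Real.one_le_rpow hn1 (by linarith))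
    exact_mod_cast this
  have hk2 : (plantSize δ n : ℝ) ≤ √n := by
    refine (Nat.floor_le (by positivity)).trans ?_
    rw [Real.sqrt_eq_rpow]
    exact Real.rpow_le_rpow_of_exponent_le hn1 (by linarith)
  have hge : 1 ≤ √n / (plantSize δ n : ℝ) := (one_le_div (by linarith)).2 hk2
  have hle : √n / (plantSize δ n : ℝ) ≤ n := by
    refine (div_le_self (Real.sqrt_nonneg _) hk1).trans ?_
    exact Real.sqrt_le_iff.2 ⟨hn0.le, by nlinarith⟩
  have hlog0 := Real.log_nonneg hge
  have hlog1 := Real.log_le_log (by linarith) hle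
  rw [Real.norm_of_nonneg (sq_nonneg _), Real.norm_of_nonneg (by positivity)] at h1
  rw [Real.norm_of_nonneg (by positivity), Real.norm_of_nonneg (by linarith),
    div_le_iff₀ (by positivity)]
  calc m n ^ 2 ≤ ε * ((σ n : ℝ) ^ 2 * Real.log (√n / plantSize δ n)) := h1
    _ ≤ ε * ((σ n : ℝ) ^ 2 * Real.log n) := by gcongr
    _ = _ := by ring

/-- The exponent of the lower bound for `VSTAT` is of order `log n / L n`. -/
lemma eventually_le_exponent {δ : ℝ} (hδ₀ : 0 < δ) {L : ℕ → ℝ} (hL : ∀ n, 1 ≤ L n)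
    (hLo : Tendsto (fun n : ℕ => L n / Real.log n) atTop (𝓝 0)) :
    ∀ᶠ n : ℕ in atTop, δ ^ 2 / 2 * (Real.log n / L n) ≤ δ ^ 2 * (Real.log n / L n) - 1 := by
  filter_upwards [(tendsto_exponent hδ₀ hL hLo).eventually_ge_atTop 1] with n hn
  linarith

end Regimes

theorem mainTheorem3 (M : PlantingModel) (δ : ℝ) (hδ₀ : 0 < δ) (hδ₁ : δ ≤ 1 / 2) :
    -- mean zero, variance ratio bounded away from `0` and from `2`
    (∀ c ε : ℝ, 0 < c → 0 < ε →
      ∃ a > (0 : ℝ), ∃ b > (0 : ℝ), ∀ᶠ n : ℕ in atTop, ∀ σ₀ σ₁ : ℝ≥0, 0 < σ₀ →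
        c * (σ₀ : ℝ) ^ 2 ≤ (σ₁ : ℝ) ^ 2 → (σ₁ : ℝ) ^ 2 ≤ 2 * (σ₀ : ℝ) ^ 2 * (1 - ε) →
          DetectionNeedsVSTAT M δ n 0 σ₀ σ₁ ((n : ℝ) ^ (a * Real.log n)) ∧
          DetectionNeedsOneSTAT M δ n 0 σ₀ σ₁ (b * (n : ℝ) ^ (1 + δ))) ∧
    -- mean zero, variance ratio exactly `2`
    (∃ a > (0 : ℝ), ∃ b > (0 : ℝ), ∀ᶠ n : ℕ in atTop, ∀ σ₀ σ₁ : ℝ≥0, 0 < σ₀ →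
        (σ₁ : ℝ) ^ 2 = 2 * (σ₀ : ℝ) ^ 2 →
          DetectionNeedsVSTAT M δ n 0 σ₀ σ₁
            ((n : ℝ) ^ (a * (Real.log n / Real.log (Real.log n)))) ∧
          DetectionNeedsOneSTAT M δ n 0 σ₀ σ₁ (b * (n : ℝ) ^ (1 + δ))) ∧
    -- mean zero, variance ratio bounded away from `0` and at most `2 + o(δ)`
    (∀ (c : ℝ) (α : ℕ → ℝ), 0 < c → α =o[atTop] (fun _ => δ) →
      ∃ w : ℕ → ℝ, Tendsto w atTop atTop ∧ ∃ b > (0 : ℝ), ∀ᶠ n : ℕ in atTop,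
        ∀ σ₀ σ₁ : ℝ≥0, 0 < σ₀ →
        c * (σ₀ : ℝ) ^ 2 ≤ (σ₁ : ℝ) ^ 2 → (σ₁ : ℝ) ^ 2 ≤ (2 + α n) * (σ₀ : ℝ) ^ 2 →
          DetectionNeedsVSTAT M δ n 0 σ₀ σ₁ ((n : ℝ) ^ (w n)) ∧
          DetectionNeedsOneSTAT M δ n 0 σ₀ σ₁ (b * (n : ℝ) ^ (1 + δ))) ∧
    -- equal variances, mean `o(σ √(ln (√n / k)))`
    (∀ (m : ℕ → ℝ) (σ : ℕ → ℝ≥0), (∀ n, 0 < σ n) →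
      (fun n => m n ^ 2) =o[atTop]
        (fun n => (σ n : ℝ) ^ 2 * Real.log (Real.sqrt n / plantSize δ n)) →
      ∃ w : ℕ → ℝ, Tendsto w atTop atTop ∧ ∃ b > (0 : ℝ), ∀ᶠ n : ℕ in atTop,
          DetectionNeedsVSTAT M δ n (m n) (σ n) (σ n) ((n : ℝ) ^ (w n)) ∧
          DetectionNeedsOneSTAT M δ n (m n) (σ n) (σ n) (b * (n : ℝ) ^ (1 + δ))) := by
  refine ⟨fun c ε hc hε => ?_, ?_, fun c α hc hα => ?_, fun m σ hσ hm => ?_⟩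
  · -- the second moment is bounded by a constant
    set L : ℝ := 1 + Real.log (1 + 1 / (c * √ε)) with hL
    have hpos : 0 < 1 / (c * √ε) := by
      have := Real.sqrt_pos.2 hε
      positivity
    have hL1 : 1 ≤ L := by linarith [Real.log_nonneg (by linarith : 1 ≤ 1 + 1 / (c * √ε))]
    have hLo : Tendsto (fun n : ℕ => L / Real.log n) atTop (𝓝 0) :=
      tendsto_const_nhds.div_atTop tendsto_log_natCast_atTop
    have hexpL : 1 / (c * √ε) ≤ Real.exp L - 1 := by
      rw [hL, Real.exp_add, Real.exp_log (by linarith)]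
      nlinarith [Real.add_one_le_exp (1 : ℝ)]
    refine ⟨δ ^ 2 / (2 * L), by positivity, 1 / 32, by norm_num, ?_⟩
    filter_upwards [eventually_detectionNeeds hδ₀ hδ₁ (fun _ => hL1) hLo,
      eventually_le_exponent hδ₀ (fun _ => hL1) hLo, eventually_ge_atTop 1]
      with n hkey hexp hn σ₀ σ₁ h₀ hlow hup
    obtain ⟨h1, h2⟩ := hkey M 0 σ₀ σ₁
      ((hasTruncatedDensity_of_le_two_mul hc hε h₀ hlow hup).mono (by positivity) hexpL)
    refine ⟨h1.rpow_mono hn (le_trans (le_of_eq ?_) hexp), h2⟩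
    rw [div_mul_div_comm, div_mul_eq_mul_div]
  · -- the second moment is polylogarithmic
    have hα : Tendsto (fun _ : ℕ => (0 : ℝ)) atTop (𝓝 0) := tendsto_const_nhds
    have hL := one_le_truncationExponent fun _ => 0
    have hLo := tendsto_truncationExponent_div_log hα
    have hloglog : Tendsto (fun n : ℕ => Real.log (Real.log n)) atTop atTop :=
      Real.tendsto_log_atTop.comp tendsto_log_natCast_atTop
    refine ⟨δ ^ 2 / 4, by positivity, 1 / 32, by norm_num, ?_⟩
    filter_upwards [eventually_detectionNeeds hδ₀ hδ₁ hL hLo, eventually_le_exponent hδ₀ hL hLo,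
      eventually_hasTruncatedDensity two_pos hα, hloglog.eventually_ge_atTop 1,
      eventually_ge_atTop 1] with n hkey hexp htrunc hll hn σ₀ σ₁ h₀ heq
    obtain ⟨h1, h2⟩ := hkey M 0 σ₀ σ₁ (htrunc σ₀ σ₁ h₀ heq.ge (by rw [add_zero]; exact heq.le))
    refine ⟨h1.rpow_mono hn (le_trans ?_ hexp), h2⟩
    have hLn : truncationExponent (fun _ => 0) n ≤ 2 * Real.log (Real.log n) := by
      rw [truncationExponent, abs_of_nonneg (by linarith), abs_zero]
      linarith
    have hlog := Real.log_natCast_nonneg n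
    calc δ ^ 2 / 4 * (Real.log n / Real.log (Real.log n))
        = δ ^ 2 / 2 * (Real.log n / (2 * Real.log (Real.log n))) := by
          field_simp
          ring
      _ ≤ δ ^ 2 / 2 * (Real.log n / truncationExponent (fun _ => 0) n) := by
          have : 0 < truncationExponent (fun _ => 0) n := by linarith [hL n]
          gcongr
  · -- the second moment is `n ^ o(1)`
    rw [isLittleO_const_iff hδ₀.ne'] at hα
    have hL := one_le_truncationExponent α
    have hLo := tendsto_truncationExponent_div_log hα
    refine ⟨_, tendsto_exponent hδ₀ hL hLo, 1 / 32, by norm_num, ?_⟩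
    filter_upwards [eventually_detectionNeeds hδ₀ hδ₁ hL hLo,
      eventually_hasTruncatedDensity hc hα] with n hkey htrunc σ₀ σ₁ h₀ hlow hup
    exact hkey M 0 σ₀ σ₁ (htrunc σ₀ σ₁ h₀ hlow hup)
  · -- the second moment is `exp (m² / σ²)`
    have hLo := tendsto_one_add_div_log (tendsto_sq_div_sq_div_log hδ₀ hδ₁ hσ hm)
    have hL : ∀ n, 1 ≤ 1 + m n ^ 2 / (σ n : ℝ) ^ 2 := fun n => by
      linarith [show 0 ≤ m n ^ 2 / (σ n : ℝ) ^ 2 by positivity]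
    refine ⟨_, tendsto_exponent hδ₀ hL hLo, 1 / 32, by norm_num, ?_⟩
    filter_upwards [eventually_detectionNeeds hδ₀ hδ₁ hL hLo] with n hkey
    refine hkey M (m n) (σ n) (σ n)
      ((hasTruncatedDensity_shift (m n) (hσ n)).mono (by positivity) ?_)
    rw [Real.exp_add]
    nlinarith [Real.add_one_le_exp (1 : ℝ),
      Real.one_le_exp (show 0 ≤ m n ^ 2 / (σ n : ℝ) ^ 2 by positivity)]
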